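/- Let $N\ge 1$, and let $\varphi:\mathbb C\to[-\infty,+\infty)$ be a subharmonic function with $$\limsup_{|z|\to\infty}\frac{\varphi(z)}{\log|z|}=\gamma$$ for some real number $\gamma\ge 0$. Let the Riesz measure $\frac1{2\pi}\Delta\varphi$ of $\varphi$ (with the Laplacian taken in the sense of distributions) be decomposed as $$\frac1{2\pi}\Delta\varphi=\sum_{j}\alpha_j\,\delta_{a_j}+\mu,$$ where $(a_j)_j$ is a finite or countably infinite family of distinct points of $\mathbb C$, $\delta_{a_j}$ is the Dirac measure at $a_j$, the weight $$\alpha_j=\nu(\varphi,a_j):=\lim_{r\to0^+}\frac{\max_{|z-a_j|=r}\varphi(z)}{\log r}>0$$ is the Lelong number of $\varphi$ at $a_j$, and $\mu$ is a nonnegative measure that vanishes on countable sets. Let $$D_\varphi=\{(z,w)\in\mathbb C\times\mathbb C^N:\ \|w\|<e^{-\varphi(z)}\},$$ where $\|\cdot\|$ is the maximum norm, and let $L^2_h(D_\varphi)$ be the space of holomorphic functions on $D_\varphi$ that are square integrable with respect to Lebesgue measure. Let $n\in\mathbb Z_{\ge0}^N$ be a multi-index, $|n|=n_1+\dots+n_N$,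 and let $[x]$ denote the largest integer not greater than $x$. Then the following conditions are equivalent: (1) there exists an entire function $f_n\not\equiv0$ such that the function $(z,w)\mapsto f_n(z)w^n$ belongs to $L^2_h(D_\varphi)$; (2) $\displaystyle\sum_{j}\,[(N+|n|)\alpha_j]<(N+|n|)\gamma-1$. Moreover, every entire function $f_n\not\equiv0$ such that $f_n(z)w^n\in L^2_h(D_\varphi)$ is a polynomial of degree less than $(N+|n|)\gamma-1$. -/

import Mathlib

open MeasureTheory Filter Topology
open scoped ENNReal ContDiff

noncomputable section

/-- The mean of `u` over the circle of centre `a` and radius `r`, as an extended real number: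
the integral of the positive part minus the integral of the negative part, over `2π`.
For `u` upper semicontinuous and nowhere `+∞` the first integral is finite, so that the
difference is the usual integral, with values in `[-∞, +∞)`. -/
def circleMean (u : ℂ → EReal) (a : ℂ) (r : ℝ) : EReal :=
  (((∫⁻ t in Set.Ioc 0 (2 * Real.pi), (u (circleMap a r t)).toENNReal : ℝ≥0∞) : EReal)
    - ((∫⁻ t in Set.Ioc 0 (2 * Real.pi), (-u (circleMap a r t)).toENNReal : ℝ≥0∞) : EReal))
    / ((2 * Real.pi : ℝ) : EReal)

/-- Subharmonic functions on `ℂ`: upper semicontinuous, with values in `[-∞, +∞)`, and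
satisfying the submean value inequality on every circle. -/
structure IsSubharmonic (u : ℂ → EReal) : Prop where
  upperSemicontinuous : UpperSemicontinuous u
  lt_top : ∀ z, u z < ⊤
  le_circleMean : ∀ (a : ℂ) (r : ℝ), 0 < r → u a ≤ circleMean u a r

/-- `M(u, a, r)`, the maximum of `u` on the circle `|z - a| = r`. -/
def circleMax (u : ℂ → EReal) (a : ℂ) (r : ℝ) : EReal :=
  ⨆ z ∈ Metric.sphere a r, u z

/-- `ν` is the Lelong number of `u` at `a`, that is, `M(u, a, r) / log r → ν` as `r → 0⁺`. -/
def HasLelongNumber (u : ℂ → EReal) (a : ℂ) (ν : ℝ) : Prop :=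
  Tendsto (fun r : ℝ => circleMax u a r / (Real.log r : EReal)) (𝓝[>] 0) (𝓝 (ν : EReal))

/-- `ρ` is the Riesz measure `(1 / 2π) Δ u` of `u`: a locally finite Borel measure which is
`(1 / 2π)` times the Laplacian of `u` in the sense of distributions. A subharmonic function
`u ≢ -∞` takes the value `-∞` only on a null set, where `toReal` makes it `0`. -/
structure IsRieszMeasure (u : ℂ → EReal) (ρ : Measure ℂ) : Prop where
  locallyFinite : IsLocallyFiniteMeasure ρ
  laplacian_eq : ∀ ψ : ℂ → ℝ, ContDiff ℝ ∞ ψ → HasCompactSupport ψ →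
    ∫ z, (u z).toReal * Laplacian.laplacian ψ z = 2 * Real.pi * ∫ z, ψ z ∂ρ

/-- The decomposition `∑ⱼ αⱼ δ_{aⱼ} + μ` of the Riesz measure of `u`, with countably many distinct
points `aⱼ`, the Lelong numbers `αⱼ > 0` of `u` at these points, and a measure `μ` that vanishes
on countable sets. -/
structure IsRieszDecomposition {ι : Type*} (u : ℂ → EReal) (a : ι → ℂ) (α : ι → ℝ)
    (μ : Measure ℂ) : Prop where
  countable : Countable ι
  injective : Function.Injective a
  pos : ∀ j, 0 < α j
  lelong : ∀ j, HasLelongNumber u (a j) (α j)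
  null_of_countable : ∀ s : Set ℂ, s.Countable → μ s = 0
  riesz : IsRieszMeasure u
    (Measure.sum (fun j => ENNReal.ofReal (α j) • Measure.dirac (a j)) + μ)

/-- The Hartogs domain `D_φ = {(z, w) ∈ ℂ × ℂᴺ : ‖w‖ < e^{-φ(z)}}`, where `‖w‖` is the maximum
norm (the norm of `Fin N → ℂ`), and `e^{-φ(z)} = +∞` if `φ(z) = -∞`. -/
def hartogsDomain (N : ℕ) (φ : ℂ → EReal) : Set (ℂ × (Fin N → ℂ)) :=
  {p | ‖p.2‖ₑ < EReal.exp (-φ p.1)}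

/-- `F` belongs to `L²_h(D)`: it is holomorphic on `D` and square integrable on `D` with respect
to Lebesgue measure. -/
def MemBergman {N : ℕ} (D : Set (ℂ × (Fin N → ℂ))) (F : ℂ × (Fin N → ℂ) → ℂ) : Prop :=
  DifferentiableOn ℂ F D ∧ MemLp F 2 (volume.restrict D)

/-- `f` is entire, `f ≢ 0`, and `f(z) wⁿ` belongs to `L²_h(D_φ)`. -/
def IsBergmanCoefficient {N : ℕ} (φ : ℂ → EReal) (n : Fin N → ℕ) (f : ℂ → ℂ) : Prop :=
  Differentiable ℂ f ∧ f ≠ 0 ∧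
    MemBergman (hartogsDomain N φ) (fun p => f p.1 * ∏ i, p.2 i ^ n i)

end

/-! Put `k = N + |n|`. Integrating over the fibres, which are polydiscs of radius `e^{-φ(z)}`, turns
square integrability of `f(z) wⁿ` into `∫ |f|² e^{-2kφ} < ∞` on the plane
(`isBergmanCoefficient_iff`). Since `φ` grows at most logarithmically, such an `f` is a polynomial.
What remains is to compare `e^{-2kφ}` with powers of `|z|` at infinity and of `|z - a|` at each atom
`a` of the Riesz measure `ρ`.

Circle means are replaced by means `A_R(b)` against a smooth radial probability density which is `1
/ 2π` times the Laplacian of a truncated logarithm. Testing `Δφ` on the difference of two truncated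
logarithms gives a Jensen formula (`kernelMean_sub`): `A_R(b) - A_ε(b)` is the `ρ`-integral of a
cut-off logarithm. It yields `A_ε(a) ≤ A_1(a) + ρ{a} log ε` for `ε ≤ 1`, the bound of `φ(b)` from
below by `A_R(b)` minus a local potential, and, with a Harnack type comparison of means, the total
mass `ρ(ℂ) = γ`.

Necessity: Jensen's inequality for `exp` bounds the integral over an annulus of radius `R` from
below by a constant times `R^{2d + 2 - 2kγ}` at infinity (`d` the degree), and by a constant times
`R^{2m + 2 - 2kρ{a}}` at a point `a` (`m` the multiplicity of the root). Infinitely many disjoint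
annuli force `d < kγ - 1` and `m ≥ ⌊kρ{a}⌋` (`natDegree_lt_of_weighted`,
`floor_le_rootMultiplicity`). Summing multiplicities gives condition (2).

Sufficiency: the witness is `∏ (z - a_j)^⌊k α_j⌋`. Near a point, the zero weakens the singularity of
the atom to an exponent below `2`, while the remaining nearby mass is at most a small `δ`. Jensen's
inequality for `ρ` and Tonelli's theorem replace the potential of that mass by an average of
integrable singularities `|w - z|^{-2kδ}` (`exists_ball_setLIntegral_lt_top`). At infinity, the
means grow like `γ log |z|` and the mass outside a large disc is small
(`exists_compl_setLIntegral_lt_top`). -/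

/-! ### A smooth step and a smooth convex ramp -/

/-- A smooth bump on the real line, centred at `1 / 2` and supported in `[0, 1]`. -/
noncomputable def unitBump : ContDiffBump (1 / 2 : ℝ) := ⟨1 / 4, 1 / 2, by norm_num, by norm_num⟩

/-- A smooth probability density on `[0, 1]`. -/
noncomputable def profile (t : ℝ) : ℝ := unitBump.normed volume t

/-- The primitive of `profile` vanishing at `0`, a smooth step from `0` to `1`. -/
noncomputable def profileStep (t : ℝ) : ℝ := ∫ s in (0 : ℝ)..t, profile s

/-- The second primitive of `profile`, a smooth convex replacement of `max t 0`. -/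
noncomputable def softRamp (t : ℝ) : ℝ := ∫ s in (0 : ℝ)..t, profileStep s

lemma profile_contDiff : ContDiff ℝ ∞ profile := unitBump.contDiff_normed (n := ⊤)

lemma profile_continuous : Continuous profile := profile_contDiff.continuous

lemma profile_nonneg (t : ℝ) : 0 ≤ profile t := unitBump.nonneg_normed t

lemma support_profile : Function.support profile = Set.Ioo 0 1 := by
  have h := unitBump.support_normed_eq (μ := volume)
  rw [Real.ball_eq_Ioo] at h
  have : Function.support profile = Function.support (unitBump.normed volume) := rfl
  rw [this, h]
  norm_num [unitBump]

lemma profile_eq_zero {t : ℝ} (ht : t ∉ Set.Ioo (0 : ℝ) 1) : profile t = 0 := by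
  rw [← support_profile] at ht
  simpa using ht

lemma hasDerivAt_profileStep (t : ℝ) : HasDerivAt profileStep (profile t) t :=
  intervalIntegral.integral_hasDerivAt_right (profile_continuous.intervalIntegrable _ _)
    (profile_continuous.stronglyMeasurableAtFilter _ _) profile_continuous.continuousAt

lemma profileStep_contDiff : ContDiff ℝ ∞ profileStep := by
  rw [contDiff_infty_iff_deriv]
  refine ⟨fun t => (hasDerivAt_profileStep t).differentiableAt, ?_⟩
  rw [show deriv profileStep = profile from funext fun t => (hasDerivAt_profileStep t).deriv]
  exact profile_contDiff

lemma profileStep_continuous : Continuous profileStep := profileStep_contDiff.continuous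

lemma hasDerivAt_softRamp (t : ℝ) : HasDerivAt softRamp (profileStep t) t :=
  intervalIntegral.integral_hasDerivAt_right (profileStep_continuous.intervalIntegrable _ _)
    (profileStep_continuous.stronglyMeasurableAtFilter _ _) profileStep_continuous.continuousAt

lemma softRamp_contDiff : ContDiff ℝ ∞ softRamp := by
  rw [contDiff_infty_iff_deriv]
  refine ⟨fun t => (hasDerivAt_softRamp t).differentiableAt, ?_⟩
  rw [show deriv softRamp = profileStep from funext fun t => (hasDerivAt_softRamp t).deriv]
  exact profileStep_contDiff

lemma deriv_softRamp : deriv softRamp = profileStep :=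
  funext fun t => (hasDerivAt_softRamp t).deriv

lemma deriv_profileStep : deriv profileStep = profile :=
  funext fun t => (hasDerivAt_profileStep t).deriv

lemma profileStep_monotone : Monotone profileStep :=
  monotone_of_deriv_nonneg (fun t => (hasDerivAt_profileStep t).differentiableAt)
    (fun t => by rw [deriv_profileStep]; exact profile_nonneg t)

lemma profileStep_zero : profileStep 0 = 0 := by simp [profileStep]

lemma profileStep_of_nonpos {t : ℝ} (ht : t ≤ 0) : profileStep t = 0 := by
  rw [profileStep, intervalIntegral.integral_congr (g := fun _ => (0 : ℝ))]
  · simp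
  · intro s hs
    rw [Set.uIcc_of_ge ht] at hs
    exact profile_eq_zero fun h => absurd h.1 (not_lt.2 hs.2)

lemma profileStep_one : profileStep 1 = 1 := by
  have h := unitBump.integral_normed (μ := (volume : Measure ℝ))
  rw [profileStep, intervalIntegral.integral_of_le zero_le_one,
    setIntegral_eq_integral_of_forall_compl_eq_zero]
  · exact h
  · intro t ht
    exact profile_eq_zero fun h => ht ⟨h.1, h.2.le⟩

lemma profileStep_of_one_le {t : ℝ} (ht : 1 ≤ t) : profileStep t = 1 := by
  have h : profileStep t = profileStep 1 + ∫ s in (1 : ℝ)..t, profile s :=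
    (intervalIntegral.integral_add_adjacent_intervals
      (profile_continuous.intervalIntegrable _ _) (profile_continuous.intervalIntegrable _ _)).symm
  rw [h, profileStep_one, intervalIntegral.integral_congr (g := fun _ => (0 : ℝ))]
  · simp
  · intro s hs
    rw [Set.uIcc_of_le ht] at hs
    exact profile_eq_zero fun h => absurd h.2 (not_lt.2 hs.1)

lemma profileStep_nonneg (t : ℝ) : 0 ≤ profileStep t := by
  rcases le_total t 0 with h | h
  · exact (profileStep_of_nonpos h).ge
  · rw [← profileStep_zero]; exact profileStep_monotone h

lemma profileStep_le_one (t : ℝ) : profileStep t ≤ 1 := by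
  rcases le_total t 1 with h | h
  · rw [← profileStep_one]; exact profileStep_monotone h
  · exact (profileStep_of_one_le h).le

lemma softRamp_zero : softRamp 0 = 0 := by simp [softRamp]

lemma softRamp_monotone : Monotone softRamp :=
  monotone_of_deriv_nonneg (fun t => (hasDerivAt_softRamp t).differentiableAt)
    (fun t => by rw [deriv_softRamp]; exact profileStep_nonneg t)

lemma softRamp_sub_le {s t : ℝ} (h : s ≤ t) : softRamp t - softRamp s ≤ t - s := by
  have hm : Monotone fun x => x - softRamp x := by
    refine monotone_of_hasDerivAt_nonneg (f' := fun x => 1 - profileStep x)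
      (fun x => (hasDerivAt_id x).sub (hasDerivAt_softRamp x)) fun x => ?_
    simpa using profileStep_le_one x
  linarith [hm h]

lemma softRamp_of_nonpos {t : ℝ} (ht : t ≤ 0) : softRamp t = 0 := by
  rw [softRamp, intervalIntegral.integral_congr (g := fun _ => (0 : ℝ))]
  · simp
  · intro s hs
    rw [Set.uIcc_of_ge ht] at hs
    exact profileStep_of_nonpos hs.2

lemma softRamp_sub_of_one_le {t : ℝ} (ht : 1 ≤ t) : softRamp t = softRamp 1 + (t - 1) := by
  have h : softRamp t = softRamp 1 + ∫ s in (1 : ℝ)..t, profileStep s :=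
    (intervalIntegral.integral_add_adjacent_intervals
      (profileStep_continuous.intervalIntegrable _ _)
      (profileStep_continuous.intervalIntegrable _ _)).symm
  rw [h, intervalIntegral.integral_congr (g := fun _ => (1 : ℝ))]
  · simp
  · intro s hs
    rw [Set.uIcc_of_le ht] at hs
    exact profileStep_of_one_le hs.1

lemma softRamp_nonneg (t : ℝ) : 0 ≤ softRamp t := by
  rcases le_total t 0 with h | h
  · exact (softRamp_of_nonpos h).ge
  · rw [← softRamp_zero]; exact softRamp_monotone h

lemma softRamp_le_max (t : ℝ) : softRamp t ≤ max t 0 := by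
  rcases le_total t 0 with h | h
  · rw [softRamp_of_nonpos h]; exact le_max_right _ _
  · have := softRamp_sub_le h
    rw [softRamp_zero] at this
    exact le_max_of_le_left (by linarith)

lemma sub_one_le_softRamp (t : ℝ) : t - 1 ≤ softRamp t := by
  rcases le_total t 1 with h | h
  · linarith [softRamp_nonneg t]
  · rw [softRamp_sub_of_one_le h]; linarith [softRamp_nonneg 1]

/-- The maximal value of `profile`. -/
noncomputable def profileMax : ℝ := 1 / ∫ x, unitBump x ∂(volume : Measure ℝ)

lemma profileMax_pos : 0 < profileMax := one_div_pos.2 unitBump.integral_pos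

lemma profile_le_max (t : ℝ) : profile t ≤ profileMax := by
  rw [profile, unitBump.normed_def, profileMax]
  exact div_le_div_of_nonneg_right unitBump.le_one unitBump.integral_pos.le

/-- The plateau of the bump gives a lower bound of the kernel on part of its annulus, which the
Harnack comparison needs. -/
lemma profile_eq_max {t : ℝ} (h1 : 1 / 4 ≤ t) (h2 : t ≤ 3 / 4) : profile t = profileMax := by
  rw [profile, unitBump.normed_def, profileMax, unitBump.one_of_mem_closedBall]
  rw [Real.closedBall_eq_Icc]
  constructor <;> (norm_num [unitBump]; linarith)

/-! ### The truncated logarithm and its Laplacian -/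

/-- The potential-theoretic kernel `ℓ (log (|z| / R))`. -/
noncomputable def softLog (R : ℝ) (z : ℂ) : ℝ := softRamp (Real.log (‖z‖ / R))

/-- A smooth radial probability density supported in the annulus `R ≤ |z| ≤ e R`. -/
noncomputable def annulusKernel (R : ℝ) (z : ℂ) : ℝ :=
  profile (Real.log (‖z‖ / R)) / (2 * Real.pi * ‖z‖ ^ 2)

lemma softLog_of_norm_le {R : ℝ} (hR : 0 < R) {z : ℂ} (hz : ‖z‖ ≤ R) : softLog R z = 0 :=
  softRamp_of_nonpos (Real.log_nonpos (by positivity) ((div_le_one hR).2 hz))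

/-- The ramp vanishes on the negative axis, so the singularity of the logarithm at the origin is
never seen. -/
lemma softLog_contDiff {R : ℝ} (hR : 0 < R) : ContDiff ℝ ∞ (softLog R) := by
  rw [contDiff_iff_contDiffAt]
  intro z
  rcases eq_or_ne z 0 with rfl | hz
  · have : softLog R =ᶠ[𝓝 0] fun _ => 0 := by
      filter_upwards [Metric.ball_mem_nhds (0 : ℂ) hR] with w hw
      exact softLog_of_norm_le hR (by simpa using (mem_ball_zero_iff.1 hw).le)
    exact contDiffAt_const.congr_of_eventuallyEq this
  · refine softRamp_contDiff.contDiffAt.comp z (ContDiffAt.log ?_ ?_)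
    · exact (contDiffAt_norm ℝ hz).div_const R
    · have := norm_pos_iff.2 hz
      positivity

lemma hasFDerivAt_log_norm_div {R : ℝ} (hR : 0 < R) {z : ℂ} (hz : z ≠ 0) :
    HasFDerivAt (fun w : ℂ => Real.log (‖w‖ / R))
      ((‖z‖ ^ 2)⁻¹ • innerSL ℝ z) z := by
  have hz' := norm_pos_iff.2 hz
  have h1 : HasFDerivAt (fun w : ℂ => ‖w‖ ^ 2) (2 • innerSL ℝ z) z :=
    (hasStrictFDerivAt_norm_sq z).hasFDerivAt
  have h2 := ((h1.log (by positivity)).const_mul (1 / 2)).sub_const (Real.log R)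
  refine (h2.congr_of_eventuallyEq ?_).congr_fderiv ?_
  · filter_upwards [isOpen_ne.mem_nhds hz] with w hw
    rw [Real.log_div (norm_ne_zero_iff.2 hw) hR.ne', Real.log_pow]
    push_cast; ring
  · ext <;> (simp; ring)

/-- Since `log |z|` is harmonic with gradient of length `1 / |z|`, composing it with a function `u`
has Laplacian `u''(log |z|) / |z|²`. -/
lemma laplacian_softLog {R : ℝ} (hR : 0 < R) (z : ℂ) :
    Laplacian.laplacian (softLog R) z = 2 * Real.pi * annulusKernel R z := by
  rcases eq_or_ne z 0 with rfl | hz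
  · have h : softLog R =ᶠ[𝓝 0] fun _ => 0 := by
      filter_upwards [Metric.ball_mem_nhds (0 : ℂ) hR] with w hw
      exact softLog_of_norm_le hR (by simpa using (mem_ball_zero_iff.1 hw).le)
    have := InnerProductSpace.laplacian_congr_nhds h
    rw [this.eq_of_nhds]
    simp [annulusKernel]
  have hz' := norm_pos_iff.2 hz
  have hd : ∀ w : ℂ, w ≠ 0 → HasFDerivAt (softLog R)
      (profileStep (Real.log (‖w‖ / R)) • ((‖w‖ ^ 2)⁻¹ • innerSL ℝ w)) w := fun w hw =>
    (hasDerivAt_softRamp _).comp_hasFDerivAt w (hasFDerivAt_log_norm_div hR hw)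
  -- Summed over `v = 1` and `v = I`, the terms with `profileStep` cancel.
  have key : ∀ v : ℂ, iteratedFDeriv ℝ 2 (softLog R) z ![v, v] =
      profile (Real.log (‖z‖ / R)) * ((‖z‖ ^ 2)⁻¹ * inner ℝ z v) * ((‖z‖ ^ 2)⁻¹ * inner ℝ z v)
      + profileStep (Real.log (‖z‖ / R)) * (-(2 * inner ℝ z v) / (‖z‖ ^ 2) ^ 2 * inner ℝ z v
        + (‖z‖ ^ 2)⁻¹ * inner ℝ v v) := by
    intro v
    rw [iteratedFDeriv_two_apply]
    simp only [Matrix.cons_val_zero, Matrix.cons_val_one]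
    have hdiff : DifferentiableAt ℝ (fderiv ℝ (softLog R)) z :=
      (((softLog_contDiff hR).fderiv_right (m := 1) (by norm_cast)).differentiable
        (by norm_num)).differentiableAt
    have e1 : fderiv ℝ (fderiv ℝ (softLog R)) z v v
        = fderiv ℝ (fun w => fderiv ℝ (softLog R) w v) z v := by
      have := (hdiff.hasFDerivAt.clm_apply (hasFDerivAt_const v z)).fderiv
      rw [this]; simp
    rw [e1]
    have e2 : (fun w => fderiv ℝ (softLog R) w v) =ᶠ[𝓝 z] fun w =>
        profileStep (Real.log (‖w‖ / R)) * ((‖w‖ ^ 2)⁻¹ * inner ℝ w v) := by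
      filter_upwards [isOpen_ne.mem_nhds hz] with w hw
      rw [(hd w hw).fderiv]
      simp
    have h1 : HasFDerivAt (fun w : ℂ => ‖w‖ ^ 2) (2 • innerSL ℝ z) z :=
      (hasStrictFDerivAt_norm_sq z).hasFDerivAt
    have h2 := (hasDerivAt_inv (by positivity : ‖z‖ ^ 2 ≠ 0)).comp_hasFDerivAt z h1
    have h3 : HasFDerivAt (fun w : ℂ => inner ℝ w v) (innerSL ℝ v) z := by
      have : (fun w : ℂ => inner ℝ w v) = innerSL ℝ v := by
        ext w; simp [real_inner_comm]
      rw [this]; exact (innerSL ℝ v).hasFDerivAt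
    have h4 := ((hasDerivAt_profileStep _).comp_hasFDerivAt z
      (hasFDerivAt_log_norm_div hR hz)).mul (h2.mul h3)
    rw [e2.fderiv_eq, HasFDerivAt.fderiv (f := fun w =>
        profileStep (Real.log (‖w‖ / R)) * ((‖w‖ ^ 2)⁻¹ * inner ℝ w v)) h4]
    simp only [_root_.add_apply, _root_.smul_apply, innerSL_apply_apply,
      smul_eq_mul, Function.comp_apply, Pi.mul_apply, nsmul_eq_mul]
    simp
    ring
  rw [InnerProductSpace.laplacian_eq_iteratedFDeriv_complexPlane]
  simp only [key, annulusKernel]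
  have n2 : ‖z‖ ^ 2 = z.re ^ 2 + z.im ^ 2 := by
    rw [Complex.sq_norm, Complex.normSq_apply]; ring
  have i1 : inner ℝ z 1 = z.re := by simp [Complex.inner]
  have i2 : inner ℝ z Complex.I = z.im := by simp [Complex.inner]
  have i3 : inner ℝ Complex.I Complex.I = (1 : ℝ) := by simp
  have i4 : inner ℝ (1 : ℂ) 1 = (1 : ℝ) := by simp
  rw [i1, i2, i3, i4]
  have hpos : 0 < z.re ^ 2 + z.im ^ 2 := by rw [← n2]; positivity
  generalize profile (Real.log (‖z‖ / R)) = A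
  generalize profileStep (Real.log (‖z‖ / R)) = B
  rw [n2]
  have := Real.pi_pos
  field_simp
  ring

/-! ### Cut-off logarithms as test functions -/

/-- The compactly supported difference of two kernels `softLog`, equal to `log (R / ε)` near `0`. -/
noncomputable def logCutoff (ε R : ℝ) (z : ℂ) : ℝ :=
  Real.log (R / ε) - softLog ε z + softLog R z

section logCutoff

variable {ε R : ℝ}

lemma logCutoff_contDiff (hε : 0 < ε) (hR : 0 < R) : ContDiff ℝ ∞ (logCutoff ε R) :=
  (contDiff_const.sub (softLog_contDiff hε)).add (softLog_contDiff hR)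

lemma softLog_eq (hR : 0 < R) {z : ℂ} (hz : Real.exp 1 * R ≤ ‖z‖) :
    softLog R z = softRamp 1 + (Real.log (‖z‖ / R) - 1) := by
  apply softRamp_sub_of_one_le
  rw [Real.le_log_iff_exp_le]
  · rwa [le_div_iff₀ hR]
  · have := Real.exp_pos 1
    exact div_pos (lt_of_lt_of_le (by positivity) hz) hR

/-- Beyond `e R` both ramps are affine of slope one with the same offset, so their difference
cancels `log (R / ε)`. -/
lemma logCutoff_eq_zero (hε : 0 < ε) (h : ε ≤ R) {z : ℂ} (hz : Real.exp 1 * R ≤ ‖z‖) :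
    logCutoff ε R z = 0 := by
  have hR := hε.trans_le h
  have he := Real.exp_pos 1
  have hz0 : 0 < ‖z‖ := lt_of_lt_of_le (by positivity) hz
  rw [logCutoff, softLog_eq hR hz, softLog_eq hε (le_trans (by gcongr) hz),
    Real.log_div hR.ne' hε.ne', Real.log_div hz0.ne' hε.ne', Real.log_div hz0.ne' hR.ne']
  ring

lemma logCutoff_hasCompactSupport (hε : 0 < ε) (h : ε ≤ R) :
    HasCompactSupport (logCutoff ε R) := by
  refine HasCompactSupport.intro (isCompact_closedBall 0 (Real.exp 1 * R)) fun z hz => ?_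
  rw [mem_closedBall_zero_iff, not_le] at hz
  exact logCutoff_eq_zero hε h hz.le

lemma logCutoff_of_ne (hε : 0 < ε) (h : ε ≤ R) {z : ℂ} (hz : z ≠ 0) :
    logCutoff ε R z = Real.log (R / ε) - softRamp (Real.log (‖z‖ / R) + Real.log (R / ε))
      + softRamp (Real.log (‖z‖ / R)) := by
  have hR := hε.trans_le h
  have hz0 : ‖z‖ ≠ 0 := norm_ne_zero_iff.2 hz
  rw [logCutoff, softLog, softLog, ← Real.log_mul (by positivity) (by positivity)]
  congr 4
  field_simp

lemma logCutoff_nonneg (hε : 0 < ε) (h : ε ≤ R) (z : ℂ) : 0 ≤ logCutoff ε R z := by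
  have hR := hε.trans_le h
  have hl : 0 ≤ Real.log (R / ε) := Real.log_nonneg ((one_le_div hε).2 h)
  rcases eq_or_ne z 0 with rfl | hz
  · rw [logCutoff, softLog_of_norm_le hε (by simpa using hε.le),
      softLog_of_norm_le hR (by simpa using hR.le)]
    simpa
  · rw [logCutoff_of_ne hε h hz]
    have := softRamp_sub_le (s := Real.log (‖z‖ / R)) (t := Real.log (‖z‖ / R) + Real.log (R / ε))
      (by linarith)
    linarith

lemma logCutoff_le (hε : 0 < ε) (h : ε ≤ R) (z : ℂ) : logCutoff ε R z ≤ Real.log (R / ε) := by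
  have hR := hε.trans_le h
  have hl : 0 ≤ Real.log (R / ε) := Real.log_nonneg ((one_le_div hε).2 h)
  rcases eq_or_ne z 0 with rfl | hz
  · rw [logCutoff, softLog_of_norm_le hε (by simpa using hε.le),
      softLog_of_norm_le hR (by simpa using hR.le)]
    simp
  · rw [logCutoff_of_ne hε h hz]
    have := softRamp_monotone (show Real.log (‖z‖ / R) ≤ Real.log (‖z‖ / R) + Real.log (R / ε) by
      linarith)
    linarith

/-- The bound does not depend on `ε`, so it survives shrinking `ε`. One factor `e` pays for `t - 1 ≤
softRamp t`, the other for `softRamp ≤ 1` inside the support. -/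
lemma logCutoff_le_posLog (hε : 0 < ε) (h : ε ≤ R) {z : ℂ} (hz : z ≠ 0) :
    logCutoff ε R z ≤ Real.posLog (Real.exp 2 * R / ‖z‖) := by
  have hR := hε.trans_le h
  have hz0 : 0 < ‖z‖ := norm_pos_iff.2 hz
  rcases le_total (Real.exp 1 * R) ‖z‖ with hz1 | hz1
  · rw [logCutoff_eq_zero hε h hz1]; exact Real.posLog_nonneg
  refine le_trans ?_ (le_max_right _ _)
  rw [show Real.exp 2 * R / ‖z‖ = Real.exp 2 * (‖z‖ / R)⁻¹ by field_simp,
    Real.log_mul (Real.exp_pos _).ne' (by positivity), Real.log_exp, Real.log_inv,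
    logCutoff_of_ne hε h hz]
  have h1 := sub_one_le_softRamp (Real.log (‖z‖ / R) + Real.log (R / ε))
  have h2 : Real.log (‖z‖ / R) ≤ 1 := by
    rw [Real.log_le_iff_le_exp (by positivity), div_le_iff₀ hR]; exact hz1
  have h3 := softRamp_monotone h2
  have h4 := softRamp_le_max 1
  norm_num at h4
  linarith

lemma le_logCutoff (hε : 0 < ε) (h : ε ≤ R) {s : ℝ} (hs : ε ≤ s) {z : ℂ} (hz : ‖z‖ ≤ s) :
    Real.log (R / s) ≤ logCutoff ε R z := by
  have hR := hε.trans_le h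
  have hs0 := hε.trans_le hs
  have h2 : softLog ε z ≤ Real.log (s / ε) := by
    rcases eq_or_ne z 0 with rfl | hz'
    · rw [softLog_of_norm_le hε (by simpa using hε.le)]
      exact Real.log_nonneg ((one_le_div hε).2 hs)
    refine (softRamp_le_max _).trans (max_le ?_ (Real.log_nonneg ((one_le_div hε).2 hs)))
    have := norm_pos_iff.2 hz'
    exact Real.log_le_log (by positivity) (by gcongr)
  have h3 : 0 ≤ softLog R z := softRamp_nonneg _
  rw [logCutoff]
  rw [Real.log_div hR.ne' hs0.ne', Real.log_div hR.ne' hε.ne']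
  rw [Real.log_div hs0.ne' hε.ne'] at h2
  linarith

lemma laplacian_logCutoff_sub (hε : 0 < ε) (hR : 0 < R) (b z : ℂ) :
    Laplacian.laplacian (fun w => logCutoff ε R (w - b)) z
      = 2 * Real.pi * (annulusKernel R (z - b) - annulusKernel ε (z - b)) := by
  have e0 : (fun w => logCutoff ε R (w - b)) = fun w => logCutoff ε R (w + -b) := by
    simp only [sub_eq_add_neg]
  have e1 : Laplacian.laplacian (fun w => logCutoff ε R (w - b)) z
      = Laplacian.laplacian (logCutoff ε R) (z - b) := by
    rw [InnerProductSpace.laplacian_eq_iteratedFDeriv_complexPlane,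
      InnerProductSpace.laplacian_eq_iteratedFDeriv_complexPlane, e0]
    simp only [iteratedFDeriv_comp_add_right, sub_eq_add_neg]
  have c1 : ContDiff ℝ 2 (softLog ε) := (softLog_contDiff hε).of_le (by norm_cast)
  have c2 : ContDiff ℝ 2 (softLog R) := (softLog_contDiff hR).of_le (by norm_cast)
  have c0 : ContDiff ℝ 2 (fun _ : ℂ => Real.log (R / ε)) := contDiff_const
  have e2 : logCutoff ε R = ((fun _ => Real.log (R / ε)) - softLog ε) + softLog R := rfl
  have c3 : ContDiff ℝ 2 ((fun _ => Real.log (R / ε)) - softLog ε) := c0.sub c1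
  rw [e1, e2, ContDiffAt.laplacian_add c3.contDiffAt c2.contDiffAt,
    ContDiffAt.laplacian_sub c0.contDiffAt c1.contDiffAt, laplacian_softLog hε,
    laplacian_softLog hR]
  simp
  ring

end logCutoff

/-! ### Pointwise bounds for the annular kernel -/

section kernel

variable {R : ℝ}

lemma annulusKernel_nonneg (R : ℝ) (z : ℂ) : 0 ≤ annulusKernel R z := by
  have := profile_nonneg (Real.log (‖z‖ / R))
  have := Real.pi_pos
  unfold annulusKernel; positivity

lemma annulusKernel_of_norm_le (hR : 0 < R) {z : ℂ} (hz : ‖z‖ ≤ R) : annulusKernel R z = 0 := by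
  rw [annulusKernel, profile_eq_zero, zero_div]
  exact fun h => absurd h.1
    (not_lt.2 (Real.log_nonpos (by positivity) ((div_le_one hR).2 hz)))

lemma annulusKernel_of_le_norm (hR : 0 < R) {z : ℂ} (hz : Real.exp 1 * R ≤ ‖z‖) :
    annulusKernel R z = 0 := by
  have := Real.exp_pos 1
  have hz0 : 0 < ‖z‖ := lt_of_lt_of_le (by positivity) hz
  rw [annulusKernel, profile_eq_zero, zero_div]
  refine fun h => absurd h.2 (not_lt.2 ?_)
  rw [Real.le_log_iff_exp_le (by positivity), le_div_iff₀ hR]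
  exact hz

/-- Continuity at the origin, despite the division by `|z|²`, comes for free from the kernel being
the Laplacian of a smooth function. -/
lemma annulusKernel_continuous (hR : 0 < R) : Continuous (annulusKernel R) := by
  have h : annulusKernel R = fun z => (2 * Real.pi)⁻¹ * Laplacian.laplacian (softLog R) z := by
    ext z
    rw [laplacian_softLog hR]
    have := Real.pi_pos
    field_simp
  rw [h]
  refine continuous_const.mul ?_
  rw [InnerProductSpace.laplacian_eq_iteratedFDeriv_complexPlane]
  have := (softLog_contDiff hR).continuous_iteratedFDeriv (m := 2) (by norm_cast)
  fun_prop

lemma annulusKernel_hasCompactSupport (hR : 0 < R) : HasCompactSupport (annulusKernel R) := by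
  refine HasCompactSupport.intro (isCompact_closedBall 0 (Real.exp 1 * R)) fun z hz => ?_
  rw [mem_closedBall_zero_iff, not_le] at hz
  exact annulusKernel_of_le_norm hR hz.le

lemma annulusKernel_le (hR : 0 < R) (z : ℂ) :
    annulusKernel R z ≤ profileMax / (2 * Real.pi * R ^ 2) := by
  have := Real.pi_pos
  have := profileMax_pos
  rcases le_total ‖z‖ R with h | h
  · rw [annulusKernel_of_norm_le hR h]; positivity
  · unfold annulusKernel
    gcongr
    exact profile_le_max _

/-- A kernel centred at distance `17 / 10 * R` from the centre of another kernel. -/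
lemma annulusKernel_sub_le (hR : 0 < R) {b : ℂ} (hb : ‖b‖ = 17 / 10 * R) (z : ℂ) :
    annulusKernel (R / 10) (z - b) ≤ 400 * annulusKernel R z := by
  have hpi := Real.pi_pos
  have hm := profileMax_pos
  have he : Real.exp 1 < 2.7182818286 := Real.exp_one_lt_d9
  rcases le_total (Real.exp 1 * (R / 10)) ‖z - b‖ with h | h
  · rw [annulusKernel_of_le_norm (by positivity) h]
    have := annulusKernel_nonneg R z
    positivity
  -- As `e / 10 < 0.28`, the small kernel lives where `1.42 R ≤ |z| ≤ 1.98 R`. This lies between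
  -- `e^{1/4} R` and `e^{3/4} R`, where the profile of the large kernel is maximal.
  have h' : ‖z - b‖ ≤ 28 / 100 * R := h.trans (by nlinarith)
  have hz1 : ‖z‖ ≤ 198 / 100 * R := by
    have := norm_add_le (z - b) b
    rw [sub_add_cancel] at this
    linarith
  have hz2 : 142 / 100 * R ≤ ‖z‖ := by
    have := norm_sub_le z (z - b)
    rw [sub_sub_cancel] at this
    linarith
  have hz0 : 0 < ‖z‖ := by linarith [hR]
  have hk : annulusKernel R z = profileMax / (2 * Real.pi * ‖z‖ ^ 2) := by
    rw [annulusKernel, profile_eq_max]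
    · rw [Real.le_log_iff_exp_le (by positivity), le_div_iff₀ hR]
      refine le_trans ?_ hz2
      gcongr
      rw [← Real.le_log_iff_exp_le (by norm_num)]
      have := Real.one_sub_inv_le_log_of_pos (show (0 : ℝ) < 142 / 100 by norm_num)
      norm_num at this
      linarith
    · rw [Real.log_le_iff_le_exp (by positivity), div_le_iff₀ hR]
      refine le_trans hz1 ?_
      gcongr
      have := Real.quadratic_le_exp_of_nonneg (show (0 : ℝ) ≤ 3 / 4 by norm_num)
      norm_num at this
      linarith
  rw [hk]
  refine (annulusKernel_le (by positivity) _).trans ?_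
  rw [mul_div_assoc', div_le_div_iff₀ (by positivity) (by positivity)]
  -- The factor `400` is `4 R² / (R / 10)²`.
  have : ‖z‖ ^ 2 ≤ 4 * R ^ 2 := by nlinarith
  nlinarith [mul_pos hm hpi]

end kernel

/-! ### Polar coordinates and the mass of the kernel -/

section polar

lemma lintegral_circleMap_Ioo (v : ℂ → ℝ≥0∞) (b : ℂ) (r : ℝ) :
    ∫⁻ t in Set.Ioo (-Real.pi) Real.pi, v (circleMap b r t)
      = ∫⁻ t in Set.Ioc 0 (2 * Real.pi), v (circleMap b r t) := by
  rw [setLIntegral_congr Ioo_ae_eq_Ioc]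
  have h1 := isAddFundamentalDomain_Ioc Real.two_pi_pos (-Real.pi)
  have h2 := isAddFundamentalDomain_Ioc Real.two_pi_pos 0
  rw [show -Real.pi + 2 * Real.pi = Real.pi by ring] at h1
  rw [zero_add] at h2
  refine h1.setLIntegral_eq h2 _ fun g x => ?_
  obtain ⟨g, n, rfl⟩ := g
  simp only [AddSubgroup.vadd_def, vadd_eq_add]
  congr 1
  rw [add_comm]
  exact (periodic_circleMap b r).zsmul n x

lemma lintegral_radial_mul {F : ℝ → ℝ≥0∞} (hF : Measurable F) {v : ℂ → ℝ≥0∞}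
    (hv : Measurable v) (b : ℂ) :
    ∫⁻ z, F ‖z - b‖ * v z = ∫⁻ r in Set.Ioi (0 : ℝ), ENNReal.ofReal r * F r *
      ∫⁻ t in Set.Ioc 0 (2 * Real.pi), v (circleMap b r t) := by
  have e1 : ∫⁻ z, F ‖z - b‖ * v z = ∫⁻ z, F ‖z‖ * v (b + z) := by
    rw [← lintegral_add_left_eq_self _ b]
    simp
  have hpol : ∀ p : ℝ × ℝ, b + Complex.polarCoord.symm p = circleMap b p.1 p.2 := by
    intro p
    rw [Complex.polarCoord_symm_apply, circleMap, Complex.exp_mul_I]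
    push_cast
    rfl
  have hcm : Measurable fun p : ℝ × ℝ => circleMap b p.1 p.2 := by
    unfold circleMap; fun_prop
  rw [e1, ← Complex.lintegral_comp_polarCoord_symm, polarCoord_target,
    Measure.volume_eq_prod, ← Measure.prod_restrict, lintegral_prod]
  · refine setLIntegral_congr_fun measurableSet_Ioi fun r hr => ?_
    have hr' : (0 : ℝ) < r := hr
    simp only [hpol, Complex.norm_polarCoord_symm, abs_of_pos hr', smul_eq_mul]
    rw [← lintegral_circleMap_Ioo, ← lintegral_const_mul]
    · simp only [mul_assoc]
    · exact hv.comp (by unfold circleMap; fun_prop)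
  · refine Measurable.aemeasurable ?_
    simp only [hpol, Complex.norm_polarCoord_symm, smul_eq_mul]
    exact (ENNReal.measurable_ofReal.comp measurable_fst).mul
      ((hF.comp (measurable_fst.abs)).mul (hv.comp hcm))

lemma lintegral_radial {F : ℝ → ℝ≥0∞} (hF : Measurable F) (b : ℂ) :
    ∫⁻ z : ℂ, F ‖z - b‖ = ENNReal.ofReal (2 * Real.pi) *
      ∫⁻ r in Set.Ioi (0 : ℝ), ENNReal.ofReal r * F r := by
  have := lintegral_radial_mul hF (v := fun _ => 1) measurable_const b
  simp only [mul_one, lintegral_const, Measure.restrict_apply MeasurableSet.univ,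
    Set.univ_inter, Real.volume_Ioc, one_mul, sub_zero] at this
  rw [this, lintegral_mul_const _ (by fun_prop), mul_comm]

lemma lintegral_annulusKernel {R : ℝ} (hR : 0 < R) (b : ℂ) :
    ∫⁻ z, ENNReal.ofReal (annulusKernel R (z - b)) = 1 := by
  have hpi := Real.pi_pos
  have e1 := Real.exp_pos 1
  have hF : Measurable fun r : ℝ =>
      ENNReal.ofReal (profile (Real.log (r / R)) / (2 * Real.pi * r ^ 2)) := by
    have := profile_continuous.measurable
    fun_prop
  have h := lintegral_radial hF b
  have h0 : ∫⁻ r in Set.Ioi (0 : ℝ), ENNReal.ofReal r *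
      ENNReal.ofReal (profile (Real.log (r / R)) / (2 * Real.pi * r ^ 2))
      = ∫⁻ r in Set.Ioc R (Real.exp 1 * R), ENNReal.ofReal
        ((2 * Real.pi)⁻¹ * (profile (Real.log (r / R)) * (1 / r))) := by
    have hsub : Set.Ioc R (Real.exp 1 * R) ⊆ Set.Ioi 0 := fun r hr => hR.trans hr.1
    rw [← Set.inter_eq_self_of_subset_left hsub, ← setLIntegral_indicator measurableSet_Ioc]
    refine setLIntegral_congr_fun measurableSet_Ioi fun r hr => ?_
    have hr' : (0 : ℝ) < r := hr
    by_cases h : r ∈ Set.Ioc R (Real.exp 1 * R)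
    · rw [Set.indicator_of_mem h, ← ENNReal.ofReal_mul hr'.le]
      congr 1
      field_simp
    · rw [Set.indicator_of_notMem h, profile_eq_zero]
      · simp
      · refine fun hh => h ⟨?_, ?_⟩
        · have := (Real.log_pos_iff (by positivity)).1 hh.1
          exact (one_lt_div hR).1 this
        · have := (Real.log_le_iff_le_exp (by positivity)).1 hh.2.le
          exact (div_le_iff₀ hR).1 this
  -- In polar coordinates the density has the primitive `profileStep (log (r / R)) / 2π`, which
  -- climbs from `0` to `1 / 2π`.
  have hd : ∀ r ∈ Set.uIcc R (Real.exp 1 * R),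
      HasDerivAt (fun r => (2 * Real.pi)⁻¹ * profileStep (Real.log (r / R)))
        ((2 * Real.pi)⁻¹ * (profile (Real.log (r / R)) * (1 / r))) r := by
    intro r hr
    rw [Set.uIcc_of_le (by nlinarith [Real.one_lt_exp_iff.2 one_pos])] at hr
    have hr' : 0 < r := hR.trans_le hr.1
    have h1 : HasDerivAt (fun r => Real.log (r / R)) (1 / r) r := by
      have := ((hasDerivAt_id r).div_const R).log (div_ne_zero hr'.ne' hR.ne')
      refine this.congr_deriv ?_
      simp; field_simp
    exact ((hasDerivAt_profileStep _).comp r h1).const_mul _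
  have hle : R ≤ Real.exp 1 * R := by nlinarith [Real.one_lt_exp_iff.2 one_pos]
  have hcont : ContinuousOn (fun r => (2 * Real.pi)⁻¹ * (profile (Real.log (r / R)) * (1 / r)))
      (Set.Icc R (Real.exp 1 * R)) := by
    have hne : ∀ r ∈ Set.Icc R (Real.exp 1 * R), r ≠ 0 := fun r hr => (hR.trans_le hr.1).ne'
    have hne' : ∀ r ∈ Set.Icc R (Real.exp 1 * R), r / R ≠ 0 := fun r hr =>
      div_ne_zero (hne r hr) hR.ne'
    refine continuousOn_const.mul (ContinuousOn.mul ?_ ?_)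
    · exact profile_continuous.comp_continuousOn
        (ContinuousOn.log (continuousOn_id.div_const R) hne')
    · exact continuousOn_const.div continuousOn_id hne
  have hint := intervalIntegral.integral_eq_sub_of_hasDerivAt hd
    (hcont.intervalIntegrable_of_Icc hle)
  have hint' : IntegrableOn (fun r => (2 * Real.pi)⁻¹ * (profile (Real.log (r / R)) * (1 / r)))
      (Set.Ioc R (Real.exp 1 * R)) :=
    (intervalIntegrable_iff_integrableOn_Ioc_of_le hle).1 (hcont.intervalIntegrable_of_Icc hle)
  rw [intervalIntegral.integral_of_le hle] at hint
  have hval : (2 * Real.pi)⁻¹ * profileStep (Real.log (Real.exp 1 * R / R)) -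
      (2 * Real.pi)⁻¹ * profileStep (Real.log (R / R)) = (2 * Real.pi)⁻¹ := by
    rw [mul_div_cancel_right₀ _ hR.ne', div_self hR.ne', Real.log_exp, Real.log_one,
      profileStep_one, profileStep_zero]
    ring
  rw [hval] at hint
  have hl : ∫⁻ r in Set.Ioc R (Real.exp 1 * R), ENNReal.ofReal
        ((2 * Real.pi)⁻¹ * (profile (Real.log (r / R)) * (1 / r)))
        = ENNReal.ofReal (2 * Real.pi)⁻¹ := by
    refine (ofReal_integral_eq_lintegral_ofReal hint' ?_).symm.trans (by rw [hint])
    refine (ae_restrict_iff' measurableSet_Ioc).2 (ae_of_all _ fun r hr => ?_)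
    have := profile_nonneg (Real.log (r / R))
    have : 0 < r := hR.trans hr.1
    simp only [Pi.zero_apply]
    positivity
  rw [show (fun z => ENNReal.ofReal (annulusKernel R (z - b))) = fun z =>
    ENNReal.ofReal (profile (Real.log (‖z - b‖ / R)) / (2 * Real.pi * ‖z - b‖ ^ 2)) from rfl]
  rw [h, h0, hl, ← ENNReal.ofReal_mul (by positivity), mul_inv_cancel₀ (by positivity),
    ENNReal.ofReal_one]

lemma integrable_annulusKernel {R : ℝ} (hR : 0 < R) (b : ℂ) :
    Integrable fun z => annulusKernel R (z - b) := by
  have := (annulusKernel_continuous hR).integrable_of_hasCompactSupport (μ := volume)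
    (annulusKernel_hasCompactSupport hR)
  exact this.comp_sub_right b

lemma integral_annulusKernel {R : ℝ} (hR : 0 < R) (b : ℂ) :
    ∫ z, annulusKernel R (z - b) = 1 := by
  rw [integral_eq_lintegral_of_nonneg_ae (ae_of_all _ fun z => annulusKernel_nonneg R _)
    (integrable_annulusKernel hR b).aestronglyMeasurable, lintegral_annulusKernel hR]
  rfl

end polar

/-! ### Kernel means of subharmonic functions -/

/-- The mean of `φ` against the radial kernel of scale `R` centred at `b`. -/
noncomputable def kernelMean (φ : ℂ → EReal) (R : ℝ) (b : ℂ) : ℝ :=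
  ∫ z, annulusKernel R (z - b) * (φ z).toReal

namespace IsSubharmonic

variable {φ : ℂ → EReal} (hφ : IsSubharmonic φ)
include hφ

lemma measurable : Measurable φ := hφ.upperSemicontinuous.measurable

lemma exists_le_on_closedBall (b : ℂ) (r : ℝ) :
    ∃ K : ℝ, 0 ≤ K ∧ ∀ z ∈ Metric.closedBall b r, φ z ≤ K := by
  rcases (Metric.closedBall b r).eq_empty_or_nonempty with h | h
  · exact ⟨0, le_rfl, by simp [h]⟩
  obtain ⟨z₀, -, hz₀⟩ := (hφ.upperSemicontinuous.upperSemicontinuousOn _).exists_isMaxOn h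
    (isCompact_closedBall b r)
  refine ⟨max (φ z₀).toReal 0, le_max_right _ _, fun z hz => (hz₀ hz).trans ?_⟩
  refine (EReal.le_coe_toReal (hφ.lt_top z₀).ne).trans ?_
  exact EReal.coe_le_coe_iff.2 (le_max_left _ _)

lemma measurable_sub (K : ℝ) : Measurable fun z => ((K : EReal) - φ z).toENNReal := by
  have := hφ.measurable
  fun_prop

/-- The submean inequality passes to the nonnegative function `K - φ`, for which Lebesgue integrals
make sense before any integrability of `φ` is known. -/
lemma lintegral_circle_le {b : ℂ} {r K : ℝ} (hr : 0 < r) (hK : 0 ≤ K)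
    (h : ∀ z ∈ Metric.closedBall b r, φ z ≤ K) :
    ∫⁻ t in Set.Ioc 0 (2 * Real.pi), ((K : EReal) - φ (circleMap b r t)).toENNReal
      ≤ ENNReal.ofReal (2 * Real.pi) * ((K : EReal) - φ b).toENNReal := by
  have hpi := Real.pi_pos
  have hc : Measurable (circleMap b r) := by unfold circleMap; fun_prop
  have hm := hφ.measurable.comp hc
  have hle : ∀ t, φ (circleMap b r t) ≤ K := fun t =>
    h _ (circleMap_mem_closedBall _ hr.le _)
  set V := ∫⁻ t in Set.Ioc 0 (2 * Real.pi), ((K : EReal) - φ (circleMap b r t)).toENNReal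
  set P := ∫⁻ t in Set.Ioc 0 (2 * Real.pi), (φ (circleMap b r t)).toENNReal with hP
  set Q := ∫⁻ t in Set.Ioc 0 (2 * Real.pi), (-φ (circleMap b r t)).toENNReal with hQ
  -- A subtraction-free form of `(K - x) + x⁺ = K + x⁻`, valid also for `x = -∞`.
  have hpt : ∀ x : EReal, x ≤ K → ((K : EReal) - x).toENNReal + x.toENNReal
      = ENNReal.ofReal K + (-x).toENNReal := by
    intro x hx
    induction x with
    | bot => simp
    | top => simp at hx
    | coe x =>
      have hx' : x ≤ K := EReal.coe_le_coe_iff.1 hx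
      rw [← EReal.coe_sub, ← EReal.coe_neg, EReal.toENNReal_of_ne_top (EReal.coe_ne_top _),
        EReal.toENNReal_of_ne_top (EReal.coe_ne_top _),
        EReal.toENNReal_of_ne_top (EReal.coe_ne_top _)]
      simp only [EReal.toReal_coe]
      rcases le_total 0 x with h0 | h0
      · rw [ENNReal.ofReal_of_nonpos (p := -x) (by linarith), add_zero,
          ← ENNReal.ofReal_add (by linarith) h0]
        congr 1; ring
      · rw [ENNReal.ofReal_of_nonpos h0, add_zero, ← ENNReal.ofReal_add hK (by linarith)]
        congr 1
  have hsum : V + P = ENNReal.ofReal (2 * Real.pi * K) + Q := by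
    have := lintegral_add_right (μ := volume.restrict (Set.Ioc 0 (2 * Real.pi)))
      (fun t => ((K : EReal) - φ (circleMap b r t)).toENNReal) hm.ereal_toENNReal
    refine this.symm.trans ?_
    simp only [Function.comp_apply]
    simp only [hpt _ (hle _)]
    rw [lintegral_add_left measurable_const]
    simp only [lintegral_const, Measure.restrict_apply MeasurableSet.univ, Set.univ_inter,
      Real.volume_Ioc, sub_zero]
    rw [mul_comm, ← ENNReal.ofReal_mul (by positivity)]
  have hPfin : P ≠ ⊤ := by
    refine ne_top_of_le_ne_top (b := ∫⁻ t in Set.Ioc 0 (2 * Real.pi), ENNReal.ofReal K) ?_ ?_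
    · simp [ENNReal.mul_eq_top]
    · refine lintegral_mono fun t => ?_
      refine (EReal.toENNReal_le_toENNReal (hle t)).trans ?_
      simp
  have hmean := hφ.le_circleMean b r hr
  have hmean' : φ b ≤ ((P : EReal) - (Q : EReal)) / ((2 * Real.pi : ℝ) : EReal) := hmean
  clear_value V P Q
  have h2pi : ((2 * Real.pi : ℝ) : EReal) ≠ 0 := by
    exact_mod_cast (by positivity : (2 * Real.pi : ℝ) ≠ 0)
  rcases eq_or_ne (φ b) ⊥ with hb | hb
  · rw [hb]
    simp [ENNReal.mul_top, hpi]
  lift φ b to ℝ using ⟨(hφ.lt_top b).ne, hb⟩ with x hx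
  rw [EReal.le_div_iff_mul_le (by exact_mod_cast (by positivity : (0 : ℝ) < 2 * Real.pi))
    (EReal.coe_ne_top _)] at hmean'
  lift P to NNReal using hPfin
  have hQfin : Q ≠ ⊤ := by
    rintro rfl
    simp only [EReal.coe_ennreal_top] at hmean'
    rw [EReal.sub_top, le_bot_iff, ← EReal.coe_mul] at hmean'
    exact EReal.coe_ne_bot _ hmean'
  lift Q to NNReal using hQfin
  have hVfin : V ≠ ⊤ := by
    rintro rfl
    simp at hsum
    exact ENNReal.add_ne_top.2 ⟨ENNReal.ofReal_ne_top, ENNReal.coe_ne_top⟩ hsum.symm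
  lift V to NNReal using hVfin
  have hreal : x * (2 * Real.pi) ≤ P - Q := by
    have : ((x * (2 * Real.pi) : ℝ) : EReal) ≤ (((P : ℝ) - (Q : ℝ) : ℝ) : EReal) := by
      rw [EReal.coe_mul, EReal.coe_sub, ← EReal.coe_nnreal_eq_coe_real,
        ← EReal.coe_nnreal_eq_coe_real]
      exact hmean'
    exact EReal.coe_le_coe_iff.1 this
  have hsum' : (V : ℝ) + P = 2 * Real.pi * K + Q := by
    have := congrArg ENNReal.toReal hsum
    rw [ENNReal.toReal_add (by simp) (by simp), ENNReal.toReal_add (by simp) (by simp),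
      ENNReal.toReal_ofReal (by positivity)] at this
    simpa using this
  rw [← EReal.coe_sub, EReal.toENNReal_of_ne_top (EReal.coe_ne_top _), EReal.toReal_coe,
    ← ENNReal.ofReal_mul (by positivity), ← ENNReal.ofReal_coe_nnreal]
  apply ENNReal.ofReal_le_ofReal
  nlinarith

lemma lintegral_radial_mul_le {F : ℝ → ℝ≥0∞} (hF : Measurable F) {b : ℂ} {r K : ℝ} (hK : 0 ≤ K)
    (hFr : ∀ s, r < s → F s = 0) (h : ∀ z ∈ Metric.closedBall b r, φ z ≤ K) :
    ∫⁻ z, F ‖z - b‖ * ((K : EReal) - φ z).toENNReal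
      ≤ (∫⁻ z, F ‖z - b‖) * ((K : EReal) - φ b).toENNReal := by
  rw [_root_.lintegral_radial_mul hF (hφ.measurable_sub K), lintegral_radial hF, mul_comm (ENNReal.ofReal _),
    mul_assoc, ← lintegral_mul_const _ (by fun_prop)]
  refine setLIntegral_mono' measurableSet_Ioi fun s hs => ?_
  rcases le_or_gt s r with hsr | hsr
  · gcongr
    exact hφ.lintegral_circle_le hs hK fun z hz => h z (Metric.closedBall_subset_closedBall hsr hz)
  · simp [hFr s hsr]

lemma setLIntegral_closedBall_lt_top {b : ℂ} (hb : φ b ≠ ⊥) {r K : ℝ} (hK : 0 ≤ K)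
    (h : ∀ z ∈ Metric.closedBall b r, φ z ≤ K) :
    ∫⁻ z in Metric.closedBall b r, ((K : EReal) - φ z).toENNReal < ⊤ := by
  have hF : Measurable (Set.indicator (Set.Iic r) (fun _ => (1 : ℝ≥0∞))) :=
    measurable_const.indicator measurableSet_Iic
  have key := hφ.lintegral_radial_mul_le hF hK
    (fun s hs => Set.indicator_of_notMem (by simpa using hs) _) h
  have e1 : ∀ z : ℂ, Set.indicator (Set.Iic r) (fun _ => (1 : ℝ≥0∞)) ‖z - b‖
      = Set.indicator (Metric.closedBall b r) (fun _ => (1 : ℝ≥0∞)) z := by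
    intro z
    by_cases hz : z ∈ Metric.closedBall b r
    · rw [Set.indicator_of_mem hz, Set.indicator_of_mem
        (show ‖z - b‖ ∈ Set.Iic r from mem_closedBall_iff_norm.1 hz)]
    · rw [Set.indicator_of_notMem hz,
        Set.indicator_of_notMem
          (show ‖z - b‖ ∉ Set.Iic r from fun h => hz (mem_closedBall_iff_norm.2 h))]
  simp only [e1] at key
  have e2 : ∫⁻ z, Set.indicator (Metric.closedBall b r) (fun _ => (1 : ℝ≥0∞)) z *
      ((K : EReal) - φ z).toENNReal
      = ∫⁻ z in Metric.closedBall b r, ((K : EReal) - φ z).toENNReal := by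
    rw [← lintegral_indicator Metric.isClosed_closedBall.measurableSet]
    refine lintegral_congr fun z => ?_
    by_cases hz : z ∈ Metric.closedBall b r <;> simp [hz]
  rw [e2] at key
  refine key.trans_lt (ENNReal.mul_lt_top ?_ ?_)
  · rw [lintegral_indicator Metric.isClosed_closedBall.measurableSet, setLIntegral_one]
    exact (isCompact_closedBall b r).measure_lt_top
  · rw [lt_top_iff_ne_top, Ne, EReal.toENNReal_eq_top_iff]
    lift φ b to ℝ using ⟨(hφ.lt_top b).ne, hb⟩ with x
    rw [← EReal.coe_sub]
    exact EReal.coe_ne_top _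

variable (hne : ∃ z, φ z ≠ ⊥)
include hne

/-- The disc is enlarged to one centred at a point where `φ` is finite, where the submean inequality
bounds the integral. -/
lemma setLIntegral_sub_lt_top (r : ℝ) (b : ℂ) {K : ℝ} (hK : 0 ≤ K) :
    ∫⁻ z in Metric.closedBall b r, ((K : EReal) - φ z).toENNReal < ⊤ := by
  obtain ⟨z₀, hz₀⟩ := hne
  obtain ⟨K', hK', h'⟩ := hφ.exists_le_on_closedBall z₀ (r + dist b z₀)
  have h2 := hφ.setLIntegral_closedBall_lt_top hz₀ (K := max K K') (r := r + dist b z₀)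
    (le_max_of_le_left hK)
    fun z hz => (h' z hz).trans (EReal.coe_le_coe_iff.2 (le_max_right _ _))
  refine lt_of_le_of_lt ?_ h2
  refine (lintegral_mono_set (Metric.closedBall_subset_closedBall'
    (le_refl (r + dist b z₀)))).trans ?_
  refine lintegral_mono fun z => EReal.toENNReal_le_toENNReal ?_
  exact EReal.sub_le_sub (EReal.coe_le_coe_iff.2 (le_max_left _ _)) le_rfl

lemma ae_ne_bot : ∀ᵐ z, φ z ≠ ⊥ := by
  have h : ∀ n : ℕ, ∀ᵐ z ∂(volume.restrict (Metric.closedBall (0 : ℂ) n)), φ z ≠ ⊥ := by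
    intro n
    obtain ⟨K, hK, -⟩ := hφ.exists_le_on_closedBall 0 n
    have := ae_lt_top (hφ.measurable_sub K) (hφ.setLIntegral_sub_lt_top hne n 0 hK).ne
    filter_upwards [this] with z hz hbot
    simp [hbot] at hz
  have := (ae_restrict_iUnion_iff (μ := (volume : Measure ℂ))
    (fun n : ℕ => Metric.closedBall (0 : ℂ) n) (fun z => φ z ≠ ⊥)).2 h
  rwa [Metric.iUnion_closedBall_nat, Measure.restrict_univ] at this

lemma ae_eq_toReal : ∀ᵐ z, φ z = ((φ z).toReal : EReal) := by
  filter_upwards [hφ.ae_ne_bot hne] with z hz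
  exact (EReal.coe_toReal (hφ.lt_top z).ne hz).symm

lemma integrableOn_closedBall (b : ℂ) (r : ℝ) :
    IntegrableOn (fun z => (φ z).toReal) (Metric.closedBall b r) := by
  obtain ⟨K, hK, h⟩ := hφ.exists_le_on_closedBall b r
  have h1 : IntegrableOn (fun z => K - (φ z).toReal) (Metric.closedBall b r) := by
    refine ⟨(measurable_const.sub hφ.measurable.ereal_toReal).aestronglyMeasurable, ?_⟩
    refine lt_of_le_of_lt (lintegral_mono_ae ?_) (hφ.setLIntegral_sub_lt_top hne r b hK)
    have h3 := ae_restrict_of_ae (s := Metric.closedBall b r) (hφ.ae_eq_toReal hne)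
    filter_upwards [h3, ae_restrict_mem Metric.isClosed_closedBall.measurableSet] with z hz hzb
    have hzK := h z hzb
    rw [hz] at hzK ⊢
    have hzK' := EReal.coe_le_coe_iff.1 hzK
    rw [EReal.toReal_coe, ← EReal.coe_sub, EReal.toENNReal_of_ne_top (EReal.coe_ne_top _),
      EReal.toReal_coe, Real.enorm_of_nonneg (by linarith)]
  have h2 : IntegrableOn (fun _ : ℂ => K) (Metric.closedBall b r) :=
    integrableOn_const (isCompact_closedBall b r).measure_lt_top.ne
  refine (h2.sub h1).congr (ae_of_all _ fun z => ?_)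
  simp

lemma locallyIntegrable : LocallyIntegrable fun z => (φ z).toReal := fun z =>
  ⟨Metric.closedBall z 1, Metric.closedBall_mem_nhds z one_pos,
    hφ.integrableOn_closedBall hne z 1⟩

lemma integrable_kernel_mul {R : ℝ} (hR : 0 < R) (b : ℂ) :
    Integrable fun z => annulusKernel R (z - b) * (φ z).toReal := by
  have hc : Continuous fun z => annulusKernel R (z - b) :=
    (annulusKernel_continuous hR).comp (continuous_id.sub continuous_const)
  have hs : HasCompactSupport fun z => annulusKernel R (z - b) :=
    (annulusKernel_hasCompactSupport hR).comp_homeomorph (Homeomorph.subRight b)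
  exact (hφ.locallyIntegrable hne).integrable_smul_left_of_hasCompactSupport hc hs

lemma kernelMean_const_sub {R : ℝ} (hR : 0 < R) (b : ℂ) (K : ℝ) :
    ∫ z, annulusKernel R (z - b) * (K - (φ z).toReal) = K - kernelMean φ R b := by
  simp only [mul_sub]
  rw [integral_sub ((integrable_annulusKernel hR b).mul_const K)
    (hφ.integrable_kernel_mul hne hR b), integral_mul_const, integral_annulusKernel hR, one_mul,
    kernelMean]

lemma integrable_kernel_mul_sub {R : ℝ} (hR : 0 < R) (b : ℂ) (K : ℝ) :
    Integrable fun z => annulusKernel R (z - b) * (K - (φ z).toReal) := by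
  simp only [mul_sub]
  exact ((integrable_annulusKernel hR b).mul_const K).sub (hφ.integrable_kernel_mul hne hR b)

omit hφ hne in
lemma _root_.annulusKernel_sub_of_notMem {R : ℝ} (hR : 0 < R) {b z : ℂ}
    (hz : z ∉ Metric.closedBall b (Real.exp 1 * R)) : annulusKernel R (z - b) = 0 := by
  rw [mem_closedBall_iff_norm, not_le] at hz
  exact annulusKernel_of_le_norm hR hz.le

/-- The kernel mean is at most any bound of the function on the support of the kernel. -/
lemma kernelMean_le {R : ℝ} (hR : 0 < R) {b : ℂ} {K : ℝ}
    (h : ∀ z ∈ Metric.closedBall b (Real.exp 1 * R), φ z ≤ K) : kernelMean φ R b ≤ K := by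
  rw [← sub_nonneg, ← hφ.kernelMean_const_sub hne hR b K]
  refine integral_nonneg_of_ae ?_
  filter_upwards [hφ.ae_eq_toReal hne] with z hz
  by_cases hzb : z ∈ Metric.closedBall b (Real.exp 1 * R)
  · have := h z hzb
    rw [hz] at this
    exact mul_nonneg (annulusKernel_nonneg _ _) (sub_nonneg.2 (EReal.coe_le_coe_iff.1 this))
  · simp [annulusKernel_sub_of_notMem hR hzb]

/-- A Harnack type comparison of kernel means. -/
lemma sub_kernelMean_le {R : ℝ} (hR : 0 < R) {b c : ℂ} (hbc : ‖c - b‖ = 17 / 10 * R) {K : ℝ}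
    (h : ∀ z ∈ Metric.closedBall b (Real.exp 1 * R), φ z ≤ K) :
    K - kernelMean φ (R / 10) c ≤ 400 * (K - kernelMean φ R b) := by
  rw [← hφ.kernelMean_const_sub hne (by positivity) c K, ← hφ.kernelMean_const_sub hne hR b K,
    ← integral_const_mul]
  refine integral_mono_ae (hφ.integrable_kernel_mul_sub hne (by positivity) c K)
    ((hφ.integrable_kernel_mul_sub hne hR b K).const_mul 400) ?_
  filter_upwards [hφ.ae_eq_toReal hne] with z hz
  have hk := annulusKernel_sub_le hR hbc (z - b)
  rw [sub_sub_sub_cancel_right] at hk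
  rw [← mul_assoc]
  by_cases hzb : z ∈ Metric.closedBall b (Real.exp 1 * R)
  · have := h z hzb
    rw [hz] at this
    exact mul_le_mul_of_nonneg_right hk (sub_nonneg.2 (EReal.coe_le_coe_iff.1 this))
  · rw [annulusKernel_sub_of_notMem hR hzb, mul_zero] at hk
    rw [annulusKernel_sub_of_notMem hR hzb, le_antisymm hk (annulusKernel_nonneg _ _)]
    simp

lemma le_kernelMean {R : ℝ} (hR : 0 < R) (b : ℂ) : φ b ≤ (kernelMean φ R b : EReal) := by
  rcases eq_or_ne (φ b) ⊥ with hb | hb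
  · simp [hb]
  obtain ⟨K, hK, h⟩ := hφ.exists_le_on_closedBall b (Real.exp 1 * R)
  have hbK : φ b ≤ K := h b (Metric.mem_closedBall_self (by have := Real.exp_pos 1; positivity))
  have hF : Measurable fun r : ℝ =>
      ENNReal.ofReal (profile (Real.log (r / R)) / (2 * Real.pi * r ^ 2)) := by
    have := profile_continuous.measurable
    fun_prop
  have key := hφ.lintegral_radial_mul_le hF hK (r := Real.exp 1 * R) (b := b) (fun s hs => by
    have e1 := Real.exp_pos 1
    have hs0 : 0 < s := lt_trans (by positivity) hs
    rw [profile_eq_zero, zero_div, ENNReal.ofReal_zero]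
    refine fun h => absurd h.2 (not_lt.2 ?_)
    rw [Real.le_log_iff_exp_le (by positivity), le_div_iff₀ hR]
    exact hs.le) h
  change ∫⁻ z, ENNReal.ofReal (annulusKernel R (z - b)) * _ ≤
    (∫⁻ z, ENNReal.ofReal (annulusKernel R (z - b))) * _ at key
  rw [lintegral_annulusKernel hR, one_mul] at key
  lift φ b to ℝ using ⟨(hφ.lt_top b).ne, hb⟩ with x hx
  rw [EReal.coe_le_coe_iff] at hbK ⊢
  rw [← EReal.coe_sub, EReal.toENNReal_of_ne_top (EReal.coe_ne_top _), EReal.toReal_coe] at key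
  have h1 : ENNReal.ofReal (K - kernelMean φ R b) ≤ ENNReal.ofReal (K - x) := by
    refine le_trans ?_ key
    rw [← hφ.kernelMean_const_sub hne hR b K, ofReal_integral_eq_lintegral_ofReal
      (hφ.integrable_kernel_mul_sub hne hR b K)]
    · refine lintegral_mono_ae ?_
      filter_upwards [hφ.ae_eq_toReal hne] with z hz
      rw [ENNReal.ofReal_mul (annulusKernel_nonneg _ _)]
      gcongr
      rw [hz, EReal.toReal_coe, ← EReal.coe_sub, EReal.toENNReal_of_ne_top (EReal.coe_ne_top _),
        EReal.toReal_coe]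
    · filter_upwards [hφ.ae_eq_toReal hne] with z hz
      by_cases hzb : z ∈ Metric.closedBall b (Real.exp 1 * R)
      · have := h z hzb
        rw [hz] at this
        exact mul_nonneg (annulusKernel_nonneg _ _) (sub_nonneg.2 (EReal.coe_le_coe_iff.1 this))
      · simp [annulusKernel_sub_of_notMem hR hzb]
  rw [ENNReal.ofReal_le_ofReal_iff (by linarith)] at h1
  linarith

/-- Jensen's inequality for the exponential and the kernel mean. -/
lemma ofReal_exp_le_lintegral {R : ℝ} (hR : 0 < R) (b : ℂ) (c : ℝ) :
    ENNReal.ofReal (Real.exp (-c * kernelMean φ R b)) ≤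
      ∫⁻ z, ENNReal.ofReal (annulusKernel R (z - b)) *
        ENNReal.ofReal (Real.exp (-c * (φ z).toReal)) := by
  set m := kernelMean φ R b
  -- The tangent of `x ↦ e^{-cx}` at the mean `m`, times the kernel: it lies below the integrand on
  -- the right, and its integral is exactly `e^{-cm}`.
  set g : ℂ → ℝ := fun z => Real.exp (-c * m) * ((annulusKernel R (z - b)) * (1 + c * m) -
    c * (annulusKernel R (z - b) * (φ z).toReal)) with hg
  have hgi : Integrable g := (((integrable_annulusKernel hR b).mul_const _).sub
    ((hφ.integrable_kernel_mul hne hR b).const_mul c)).const_mul _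
  have hint : ∫ z, g z = Real.exp (-c * m) := by
    rw [integral_const_mul, integral_sub ((integrable_annulusKernel hR b).mul_const _)
      ((hφ.integrable_kernel_mul hne hR b).const_mul c), integral_mul_const,
      integral_annulusKernel hR, integral_const_mul]
    change _ * (1 * (1 + c * m) - c * m) = _
    ring
  have hle : ∀ z, g z ≤ annulusKernel R (z - b) * Real.exp (-c * (φ z).toReal) := by
    intro z
    have h1 := Real.add_one_le_exp (-c * (φ z).toReal - -c * m)
    have h2 : Real.exp (-c * (φ z).toReal) =
        Real.exp (-c * m) * Real.exp (-c * (φ z).toReal - -c * m) := by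
      rw [← Real.exp_add]; congr 1; ring
    have h3 : g z = annulusKernel R (z - b) *
        (Real.exp (-c * m) * (-c * (φ z).toReal - -c * m + 1)) := by simp only [hg]; ring
    rw [h3, h2]
    have := annulusKernel_nonneg R (z - b)
    gcongr
  -- Only the positive part of `g` is kept, so the exponential need not be integrable.
  rw [← hint, integral_eq_lintegral_pos_part_sub_lintegral_neg_part hgi]
  refine (ENNReal.ofReal_le_ofReal (sub_le_self _ ENNReal.toReal_nonneg)).trans ?_
  refine ENNReal.ofReal_toReal_le.trans (lintegral_mono fun z => ?_)
  rw [← ENNReal.ofReal_mul (annulusKernel_nonneg _ _)]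
  exact ENNReal.ofReal_le_ofReal (hle z)

end IsSubharmonic

/-! ### Kernel means and the Riesz measure -/

namespace IsSubharmonic

variable {φ : ℂ → EReal} (hφ : IsSubharmonic φ) (hne : ∃ z, φ z ≠ ⊥)
  {ρ : Measure ℂ} (hρ : IsRieszMeasure φ ρ)

include hρ in
omit hφ hne in
lemma _root_.IsRieszMeasure.integrable_logCutoff {ε R : ℝ} (hε : 0 < ε) (h : ε ≤ R) (b : ℂ) :
    Integrable (fun w => logCutoff ε R (w - b)) ρ := by
  have := hρ.locallyFinite
  exact ((logCutoff_contDiff hε (hε.trans_le h)).continuous.comp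
    (continuous_id.sub continuous_const)).integrable_of_hasCompactSupport
    ((logCutoff_hasCompactSupport hε h).comp_homeomorph (Homeomorph.subRight b))

include hφ hne

lemma abs_kernelMean_le {R : ℝ} (hR : 0 < R) (p : ℂ) (r : ℝ) :
    ∃ C, ∀ b ∈ Metric.closedBall p r, |kernelMean φ R b| ≤ C := by
  refine ⟨∫ z in Metric.closedBall p (r + Real.exp 1 * R),
    profileMax / (2 * Real.pi * R ^ 2) * |(φ z).toReal|, fun b hb => ?_⟩
  rw [kernelMean, ← Real.norm_eq_abs]
  refine (norm_integral_le_integral_norm _).trans ?_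
  rw [← setIntegral_eq_integral_of_forall_compl_eq_zero
    (s := Metric.closedBall p (r + Real.exp 1 * R))]
  · refine setIntegral_mono (hφ.integrable_kernel_mul hne hR b).norm.integrableOn
      ((hφ.integrableOn_closedBall hne _ _).norm.const_mul _) fun z => ?_
    rw [norm_mul, Real.norm_of_nonneg (annulusKernel_nonneg _ _), Real.norm_eq_abs]
    gcongr
    exact annulusKernel_le hR _
  · intro z hz
    rw [annulusKernel_sub_of_notMem hR, zero_mul, norm_zero]
    intro hzb
    rw [Metric.mem_closedBall] at *
    have := dist_triangle z b p
    exact hz (by linarith)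

include hρ

/-- The growth of the kernel means is governed by the Riesz measure. -/
lemma kernelMean_sub {ε R : ℝ} (hε : 0 < ε) (h : ε ≤ R) (b : ℂ) :
    kernelMean φ R b - kernelMean φ ε b = ∫ w, logCutoff ε R (w - b) ∂ρ := by
  have hR := hε.trans_le h
  have key := hρ.laplacian_eq (fun w => logCutoff ε R (w - b))
    ((logCutoff_contDiff hε hR).comp (contDiff_id.sub contDiff_const))
    ((logCutoff_hasCompactSupport hε h).comp_homeomorph (Homeomorph.subRight b))
  have e : ∀ z, (φ z).toReal * Laplacian.laplacian (fun w => logCutoff ε R (w - b)) z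
      = 2 * Real.pi * (annulusKernel R (z - b) * (φ z).toReal
        - annulusKernel ε (z - b) * (φ z).toReal) := by
    intro z
    rw [laplacian_logCutoff_sub hε hR]; ring
  simp only [e] at key
  rw [integral_const_mul, integral_sub (hφ.integrable_kernel_mul hne hR b)
    (hφ.integrable_kernel_mul hne hε b)] at key
  exact mul_left_cancel₀ (by have := Real.pi_pos; positivity) key

/-- The lower bound of a subharmonic function by a kernel mean and the local logarithmic
potential of its Riesz measure. -/
lemma kernelMean_sub_le {R : ℝ} (hR : 0 < R) {b : ℂ} (hb : ρ {b} = 0)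
    (hint : Integrable (fun w => Real.posLog (Real.exp 2 * R / ‖w - b‖)) ρ) :
    ((kernelMean φ R b - ∫ w, Real.posLog (Real.exp 2 * R / ‖w - b‖) ∂ρ : ℝ) : EReal) ≤ φ b := by
  -- If `φ b` were smaller, upper semicontinuity would keep `φ` below some `c` around `b`, hence
  -- also the kernel means of small scale, whereas the Jensen formula keeps these above `c`.
  by_contra! hlt
  obtain ⟨c, hc1, hc2⟩ := EReal.lt_iff_exists_real_btwn.1 hlt
  have hu := hφ.upperSemicontinuous b c hc1
  obtain ⟨δ, hδ, hball⟩ := Metric.eventually_nhds_iff_ball.1 hu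
  have he := Real.exp_pos 1
  set ε := min R (δ / (2 * Real.exp 1)) with hεdef
  have hε : 0 < ε := lt_min hR (by positivity)
  have hεR : ε ≤ R := min_le_left _ _
  have h1 : kernelMean φ ε b ≤ c := by
    refine hφ.kernelMean_le hne hε fun z hz => (hball z ?_).le
    refine Metric.closedBall_subset_ball ?_ hz
    have : ε ≤ δ / (2 * Real.exp 1) := min_le_right _ _
    rw [le_div_iff₀ (by positivity)] at this
    nlinarith
  have h2 := hφ.kernelMean_sub hne hρ hε hεR b
  have h3 : ∫ w, logCutoff ε R (w - b) ∂ρ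
      ≤ ∫ w, Real.posLog (Real.exp 2 * R / ‖w - b‖) ∂ρ := by
    refine integral_mono_ae (hρ.integrable_logCutoff hε hεR b) hint ?_
    -- At `w = b` the bound fails, because `posLog (x / 0) = 0`. Hence the assumption that `b` is
    -- not an atom.
    have : ∀ᵐ w ∂ρ, w ≠ b := by
      rw [ae_iff]
      simpa using hb
    filter_upwards [this] with w hw
    exact logCutoff_le_posLog hε hεR (sub_ne_zero.2 hw)
  have h4 := EReal.coe_lt_coe_iff.1 hc2
  linarith

/-- The kernel means at a point tend to `-∞` at least as fast as the mass of the point demands. -/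
lemma kernelMean_le_of_singleton {ε : ℝ} (hε : 0 < ε) (hε1 : ε ≤ 1) (b : ℂ) :
    kernelMean φ ε b ≤ kernelMean φ 1 b + ρ.real {b} * Real.log ε := by
  have := hρ.locallyFinite
  have h := hφ.kernelMean_sub hne hρ hε hε1 b
  have h2 : ∫ w in {b}, logCutoff ε 1 (w - b) ∂ρ ≤ ∫ w, logCutoff ε 1 (w - b) ∂ρ :=
    setIntegral_le_integral (hρ.integrable_logCutoff hε hε1 b)
      (ae_of_all _ fun w => logCutoff_nonneg hε hε1 _)
  rw [integral_singleton, sub_self, smul_eq_mul] at h2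
  have h3 : logCutoff ε 1 0 = - Real.log ε := by
    rw [logCutoff, softLog_of_norm_le hε (by simpa using hε.le),
      softLog_of_norm_le one_pos (by simp)]
    simp
  rw [h3] at h2
  linarith

end IsSubharmonic

/-! ### Consequences of the growth condition -/

section growth

variable {φ : ℂ → EReal} (hφ : IsSubharmonic φ) {γ : ℝ}
  (hlim : limsup (fun z : ℂ => φ z / (Real.log ‖z‖ : EReal)) (Bornology.cobounded ℂ)
      = (γ : EReal))

include hlim

lemma exists_ne_bot_of_limsup : ∃ z, φ z ≠ ⊥ := by
  by_contra! h
  have h1 : limsup (fun z : ℂ => φ z / (Real.log ‖z‖ : EReal)) (Bornology.cobounded ℂ) = ⊥ := by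
    have : (fun z : ℂ => φ z / (Real.log ‖z‖ : EReal)) =ᶠ[Bornology.cobounded ℂ] fun _ => ⊥ := by
      filter_upwards [eventually_cobounded_le_norm (E := ℂ) 2] with z hz
      rw [h z]
      refine EReal.bot_div_of_pos_ne_top ?_ (EReal.coe_ne_top _)
      exact_mod_cast Real.log_pos (by linarith)
    rw [limsup_congr this, limsup_const]
  rw [hlim] at h1
  exact EReal.coe_ne_bot _ h1

lemma exists_ge_of_limsup {c : ℝ} (hc : c < γ) (r : ℝ) :
    ∃ z : ℂ, r ≤ ‖z‖ ∧ ((c * Real.log ‖z‖ : ℝ) : EReal) < φ z := by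
  have h := frequently_lt_of_lt_limsup (f := Bornology.cobounded ℂ)
    (u := fun z : ℂ => φ z / (Real.log ‖z‖ : EReal)) (b := (c : EReal)) (by isBoundedDefault)
    (by rw [hlim]; exact_mod_cast hc)
  obtain ⟨z, hz, hz2⟩ := (h.and_eventually (eventually_cobounded_le_norm (E := ℂ) (max r 2))).exists
  refine ⟨z, (le_max_left _ _).trans hz2, ?_⟩
  have : 0 < Real.log ‖z‖ := Real.log_pos (by linarith [(le_max_right r 2).trans hz2])
  rw [EReal.lt_div_iff (by exact_mod_cast this) (EReal.coe_ne_top _)] at hz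
  exact_mod_cast hz

include hφ

lemma exists_le_of_limsup {c : ℝ} (hc : γ < c) (hc0 : 0 ≤ c) :
    ∃ C : ℝ, 0 ≤ C ∧ ∀ z, φ z ≤ ((c * Real.posLog ‖z‖ + C : ℝ) : EReal) := by
  have h := eventually_lt_of_limsup_lt (f := Bornology.cobounded ℂ)
    (u := fun z : ℂ => φ z / (Real.log ‖z‖ : EReal)) (b := (c : EReal))
    (by rw [hlim]; exact_mod_cast hc)
  have h' := h.and (eventually_cobounded_le_norm (E := ℂ) 2)
  rw [← comap_norm_atTop, eventually_comap, eventually_atTop] at h'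
  obtain ⟨r, hr⟩ := h'
  obtain ⟨C, hC, hb⟩ := hφ.exists_le_on_closedBall 0 r
  refine ⟨C, hC, fun z => ?_⟩
  have hpl : 0 ≤ Real.posLog ‖z‖ := Real.posLog_nonneg
  rcases le_total ‖z‖ r with hz | hz
  · refine (hb z (by simpa using hz)).trans ?_
    exact_mod_cast (by nlinarith : C ≤ c * Real.posLog ‖z‖ + C)
  · obtain ⟨h1, h2⟩ := hr _ hz z rfl
    have : 0 < Real.log ‖z‖ := Real.log_pos (by linarith)
    have h3 : φ z ≤ ((c * Real.log ‖z‖ : ℝ) : EReal) := by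
      have := (EReal.div_le_iff_le_mul (by exact_mod_cast this) (EReal.coe_ne_top _)).1 h1.le
      exact_mod_cast (by rwa [mul_comm] at this)
    refine h3.trans ?_
    have : Real.log ‖z‖ ≤ Real.posLog ‖z‖ := le_max_right _ _
    exact_mod_cast (by nlinarith : c * Real.log ‖z‖ ≤ c * Real.posLog ‖z‖ + C)

end growth

/-! ### The total Riesz mass and the growth of the means -/

section mass

variable {φ : ℂ → EReal} (hφ : IsSubharmonic φ) {γ : ℝ} (hγ : 0 ≤ γ)
  (hlim : limsup (fun z : ℂ => φ z / (Real.log ‖z‖ : EReal)) (Bornology.cobounded ℂ)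
      = (γ : EReal))
  {ρ : Measure ℂ} (hρ : IsRieszMeasure φ ρ)

include hφ hlim hρ

/-- Lower bound of the kernel means at the origin by the mass of a disc. -/
lemma le_kernelMean_zero {s R : ℝ} (hs : 1 ≤ s) (hR : 1 ≤ R) :
    kernelMean φ 1 0 + ρ.real (Metric.closedBall 0 s) * (Real.log R - Real.log s)
      ≤ kernelMean φ R 0 := by
  have hne := exists_ne_bot_of_limsup hlim
  have := hρ.locallyFinite
  have h := hφ.kernelMean_sub hne hρ one_pos hR 0
  have hnn : 0 ≤ ρ.real (Metric.closedBall (0 : ℂ) s) := measureReal_nonneg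
  rcases le_total R s with hRs | hRs
  · have h0 : 0 ≤ ∫ w, logCutoff 1 R (w - 0) ∂ρ :=
      integral_nonneg fun w => logCutoff_nonneg one_pos hR _
    have : Real.log R ≤ Real.log s := Real.log_le_log (by linarith) hRs
    nlinarith
  · have h2 : ∫ w in Metric.closedBall 0 s, logCutoff 1 R (w - 0) ∂ρ
        ≤ ∫ w, logCutoff 1 R (w - 0) ∂ρ :=
      setIntegral_le_integral (hρ.integrable_logCutoff one_pos hR 0)
        (ae_of_all _ fun w => logCutoff_nonneg one_pos hR _)
    have h3 : ∫ w in Metric.closedBall (0 : ℂ) s, Real.log (R / s) ∂ρ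
        ≤ ∫ w in Metric.closedBall 0 s, logCutoff 1 R (w - 0) ∂ρ := by
      refine setIntegral_mono_on (integrableOn_const (isCompact_closedBall _ _).measure_lt_top.ne)
        (hρ.integrable_logCutoff one_pos hR 0).integrableOn
        Metric.isClosed_closedBall.measurableSet fun w hw => ?_
      exact le_logCutoff one_pos hR hs (by simpa using hw)
    rw [setIntegral_const, smul_eq_mul, Real.log_div (by linarith) (by linarith)] at h3
    linarith

omit hρ in
lemma kernelMean_zero_le_of_gt {c : ℝ} (hc : γ < c) (hc0 : 0 ≤ c) :
    ∃ C, ∀ R, 1 ≤ R → kernelMean φ R 0 ≤ c * Real.log R + C := by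
  have hne := exists_ne_bot_of_limsup hlim
  obtain ⟨C, hC, h⟩ := exists_le_of_limsup hφ hlim hc hc0
  refine ⟨c + C, fun R hR => hφ.kernelMean_le hne (by linarith) fun z hz => (h z).trans ?_⟩
  rw [EReal.coe_le_coe_iff]
  have hz' : ‖z‖ ≤ Real.exp 1 * R := by simpa using hz
  have h1 : Real.posLog ‖z‖ ≤ 1 + Real.log R := by
    refine max_le (by linarith [Real.log_nonneg hR]) ?_
    rcases eq_or_ne z 0 with rfl | hz0
    · simp; linarith [Real.log_nonneg hR]
    · have := Real.log_le_log (norm_pos_iff.2 hz0) hz'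
      rwa [Real.log_mul (Real.exp_pos 1).ne' (by linarith), Real.log_exp] at this
  nlinarith

include hγ

/-- As functions of `log R`, the means at the origin have slope at least the mass of the disc, and
at most any `c > γ`. -/
lemma measureReal_closedBall_le (s : ℝ) : ρ.real (Metric.closedBall 0 s) ≤ γ := by
  have := hρ.locallyFinite
  wlog hs : 1 ≤ s generalizing s
  · refine le_trans (measureReal_mono (Metric.closedBall_subset_closedBall (not_le.1 hs).le)
      (isCompact_closedBall _ _).measure_lt_top.ne) (this 1 le_rfl)
  refine le_of_forall_gt_imp_ge_of_dense fun c hc => ?_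
  obtain ⟨C, hC⟩ := kernelMean_zero_le_of_gt hφ hlim hc (hγ.trans hc.le)
  by_contra! hlt
  set m := ρ.real (Metric.closedBall (0 : ℂ) s)
  have hT : ∀ T : ℝ, 0 ≤ T → (m - c) * T ≤ C - kernelMean φ 1 0 + m * Real.log s := by
    intro T hT
    have h1 := le_kernelMean_zero hφ hlim hρ hs (Real.one_le_exp hT)
    have h2 := hC _ (Real.one_le_exp hT)
    rw [Real.log_exp] at h1 h2
    linarith
  have := hT ((|C - kernelMean φ 1 0 + m * Real.log s| + 1) / (m - c))
    (div_nonneg (by positivity) (by linarith))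
  rw [mul_div_cancel₀ _ (by linarith : m - c ≠ 0)] at this
  linarith [le_abs_self (C - kernelMean φ 1 0 + m * Real.log s)]

lemma measure_univ_le : ρ Set.univ ≤ ENNReal.ofReal γ := by
  have := hρ.locallyFinite
  rw [← Metric.iUnion_closedBall_nat (0 : ℂ), Monotone.measure_iUnion]
  · refine iSup_le fun n => ?_
    rw [ENNReal.le_ofReal_iff_toReal_le (isCompact_closedBall _ _).measure_lt_top.ne hγ]
    exact measureReal_closedBall_le hφ hγ hlim hρ n
  · exact fun m n h => Metric.closedBall_subset_closedBall (by exact_mod_cast h)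

lemma isFiniteMeasure_of_limsup : IsFiniteMeasure ρ :=
  ⟨(measure_univ_le hφ hγ hlim hρ).trans_lt ENNReal.ofReal_lt_top⟩

lemma measureReal_univ_le : ρ.real Set.univ ≤ γ :=
  ENNReal.toReal_le_of_le_ofReal hγ (measure_univ_le hφ hγ hlim hρ)

lemma kernelMean_zero_le {R : ℝ} (hR : 1 ≤ R) :
    kernelMean φ R 0 ≤ kernelMean φ 1 0 + ρ.real Set.univ * Real.log R := by
  have := isFiniteMeasure_of_limsup hφ hγ hlim hρ
  have h := hφ.kernelMean_sub (exists_ne_bot_of_limsup hlim) hρ one_pos hR 0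
  have h2 : ∫ w, logCutoff 1 R (w - 0) ∂ρ ≤ ∫ _, Real.log R ∂ρ :=
    integral_mono (hρ.integrable_logCutoff one_pos hR 0) (integrable_const _) fun w => by
      simpa using logCutoff_le one_pos hR (w - 0)
  rw [integral_const, smul_eq_mul] at h2
  linarith

lemma exists_measureReal_closedBall_gt {ε : ℝ} (hε : 0 < ε) :
    ∃ s, 1 ≤ s ∧ ρ.real Set.univ - ε < ρ.real (Metric.closedBall 0 s) := by
  have := isFiniteMeasure_of_limsup hφ hγ hlim hρ
  have ht : Tendsto (fun n : ℕ => ρ.real (Metric.closedBall (0 : ℂ) n)) atTop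
      (𝓝 (ρ.real Set.univ)) := by
    rw [← Metric.iUnion_closedBall_nat (0 : ℂ)]
    refine (ENNReal.tendsto_toReal (measure_ne_top _ _)).comp (tendsto_measure_iUnion_atTop ?_)
    exact fun m n h => Metric.closedBall_subset_closedBall (by exact_mod_cast h)
  obtain ⟨n, hn1, hn⟩ := ((eventually_ge_atTop 1).and
    (ht.eventually (lt_mem_nhds (sub_lt_self _ hε)))).exists
  exact ⟨n, by exact_mod_cast hn1, hn⟩

lemma le_kernelMean_zero_of_pos {ε : ℝ} (hε : 0 < ε) :
    ∃ C, ∀ R, 1 ≤ R → (ρ.real Set.univ - ε) * Real.log R - C ≤ kernelMean φ R 0 := by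
  obtain ⟨s, hs, hm⟩ := exists_measureReal_closedBall_gt hφ hγ hlim hρ hε
  refine ⟨ρ.real (Metric.closedBall 0 s) * Real.log s - kernelMean φ 1 0, fun R hR => ?_⟩
  have h := le_kernelMean_zero hφ hlim hρ hs hR
  have := Real.log_nonneg hR
  nlinarith

omit hρ in
-- The constant `K` for the Harnack comparison must itself be of size `γ log R`. The radius `6 R`
-- contains every kernel used, as `17 / 10 + e < 6`.
lemma exists_majorant {ε : ℝ} (hε : 0 < ε) :
    ∃ C, ∀ R, 1 ≤ R → ∃ K, γ * Real.log R ≤ K ∧ K ≤ (γ + ε) * Real.log R + C ∧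
      ∀ z : ℂ, ‖z‖ ≤ 6 * R → φ z ≤ (K : EReal) := by
  obtain ⟨C, hC, h⟩ := exists_le_of_limsup hφ hlim (c := γ + ε) (by linarith) (by linarith)
  have h6 : 0 ≤ Real.log 6 := Real.log_nonneg (by norm_num)
  refine ⟨(γ + ε) * Real.log 6 + C, fun R hR =>
    ⟨(γ + ε) * (Real.log 6 + Real.log R) + C, ?_, by linarith, fun z hz => (h z).trans ?_⟩⟩
  · have := Real.log_nonneg hR
    nlinarith [mul_nonneg hε.le this, mul_nonneg (hγ) h6, mul_nonneg hε.le h6]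
  · rw [EReal.coe_le_coe_iff]
    have h1 : Real.posLog ‖z‖ ≤ Real.log 6 + Real.log R := by
      rw [← Real.log_mul (by norm_num) (by linarith)]
      refine max_le (Real.log_nonneg (by linarith)) ?_
      rcases eq_or_ne z 0 with rfl | hz0
      · simpa using Real.log_nonneg (show 1 ≤ 6 * R by linarith)
      · exact Real.log_le_log (norm_pos_iff.2 hz0) hz
    nlinarith

/-- The Riesz measure has total mass at least the logarithmic growth order. -/
lemma le_measureReal_univ : γ ≤ ρ.real Set.univ := by
  by_contra! hlt
  have hne := exists_ne_bot_of_limsup hlim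
  set M := ρ.real Set.univ
  have he : Real.exp 1 < 2.7182818286 := Real.exp_one_lt_d9
  -- The Harnack factor `400` turns the deficit `γ - M` at the origin into `(γ - M) / 400`
  -- elsewhere. With half of that spent on the majorant, `φ` has slope at most `γ - (γ - M) / 800`
  -- everywhere, against the limsup.
  obtain ⟨C, hC⟩ := exists_majorant hφ hγ hlim (ε := (γ - M) / 800) (by linarith)
  obtain ⟨T, hT⟩ : ∃ T, ∀ b : ℂ, 17 ≤ ‖b‖ → φ b ≤
      ((γ - (γ - M) / 800) * Real.log ‖b‖ + T : ℝ) := by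
    refine ⟨C + kernelMean φ 1 0 / 400, fun b hb => ?_⟩
    set R := ‖b‖ * (10 / 17) with hRdef
    have hR : 10 ≤ R := by rw [hRdef]; linarith
    obtain ⟨K, hK1, hK2, hK⟩ := hC R (by linarith)
    have h1 : φ b ≤ (kernelMean φ R b : EReal) := hφ.le_kernelMean hne (by linarith) b
    refine h1.trans (EReal.coe_le_coe_iff.2 ?_)
    have h2 := hφ.sub_kernelMean_le hne (R := R) (by linarith) (b := b) (c := 0) (K := K)
      (by rw [zero_sub, norm_neg, hRdef]; ring) (fun z hz => hK z (by
        rw [mem_closedBall_iff_norm] at hz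
        have := norm_add_le (z - b) b
        rw [sub_add_cancel] at this
        nlinarith))
    have h3 := kernelMean_zero_le hφ hγ hlim hρ (R := R / 10) (by linarith)
    have hlR : Real.log R = Real.log ‖b‖ + Real.log 10 - Real.log 17 := by
      rw [hRdef, Real.log_mul (by linarith) (by norm_num), Real.log_div (by norm_num) (by norm_num)]
      ring
    rw [Real.log_div (by linarith) (by norm_num)] at h3
    have h10 : 0 ≤ Real.log 10 := Real.log_nonneg (by norm_num)
    have h17 : Real.log 10 ≤ Real.log 17 := Real.log_le_log (by norm_num) (by norm_num)
    have hM : 0 ≤ M := measureReal_nonneg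
    have h5 : (γ - (γ - M) / 800) * Real.log R ≤ (γ - (γ - M) / 800) * Real.log ‖b‖ :=
      mul_le_mul_of_nonneg_left (by linarith) (by linarith)
    have h6 := mul_nonneg hM h10
    linarith
  obtain ⟨z, hz1, hz2⟩ := exists_ge_of_limsup hlim (c := γ - (γ - M) / 1600) (by linarith)
    (max 17 (Real.exp ((|T| + 1) / ((γ - M) / 1600))))
  have h1 := hz2.trans_le (hT z ((le_max_left _ _).trans hz1))
  have h2 := EReal.coe_lt_coe_iff.1 h1
  have h3 : (|T| + 1) / ((γ - M) / 1600) ≤ Real.log ‖z‖ := by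
    rw [Real.le_log_iff_exp_le (by linarith [(le_max_left _ _).trans hz1])]
    exact (le_max_right _ _).trans hz1
  rw [div_le_iff₀ (by linarith)] at h3
  nlinarith [le_abs_self T]

/-- The kernel means grow like `γ log |b|` at infinity. -/
lemma le_kernelMean_of_norm {ε : ℝ} (hε : 0 < ε) :
    ∃ C, ∀ b : ℂ, 17 ≤ ‖b‖ → (γ - ε) * Real.log ‖b‖ - C ≤ kernelMean φ (‖b‖ / 17) b := by
  have hne := exists_ne_bot_of_limsup hlim
  have he : Real.exp 1 < 2.7182818286 := Real.exp_one_lt_d9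
  have hM : ρ.real Set.univ = γ := le_antisymm (measureReal_univ_le hφ hγ hlim hρ)
    (le_measureReal_univ hφ hγ hlim hρ)
  -- The majorant and the mean at the origin each lose `ε / 800`; multiplied by `400` the total loss
  -- is `ε`.
  obtain ⟨C, hC⟩ := exists_majorant hφ hγ hlim (ε := ε / 800) (by linarith)
  obtain ⟨C', hC'⟩ := le_kernelMean_zero_of_pos hφ hγ hlim hρ (ε := ε / 800) (by linarith)
  rw [hM] at hC'
  refine ⟨400 * (C + C') + |γ - ε| * (Real.log 17 + Real.log 10), fun b hb => ?_⟩
  set R := ‖b‖ * (10 / 17) with hRdef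
  have hR : 10 ≤ R := by rw [hRdef]; linarith
  obtain ⟨K, hK1, hK2, hK⟩ := hC R (by linarith)
  have h2 := hφ.sub_kernelMean_le hne (R := R) (by linarith) (b := 0) (c := b) (K := K)
    (by rw [sub_zero, hRdef]; ring) (fun z hz => hK z (by
      rw [mem_closedBall_zero_iff] at hz
      nlinarith))
  have h3 := hC' R (by linarith)
  rw [show R / 10 = ‖b‖ / 17 by rw [hRdef]; ring] at h2
  have hlR : Real.log R = Real.log ‖b‖ + Real.log 10 - Real.log 17 := by
    rw [hRdef, Real.log_mul (by linarith) (by norm_num), Real.log_div (by norm_num) (by norm_num)]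
    ring
  have h10 : 0 ≤ Real.log 10 := Real.log_nonneg (by norm_num)
  have h17 : 0 ≤ Real.log 17 := Real.log_nonneg (by norm_num)
  have h5 : (γ - ε) * (Real.log 17 - Real.log 10) ≤ |γ - ε| * (Real.log 17 + Real.log 10) := by
    refine (le_abs_self _).trans ?_
    rw [abs_mul]
    gcongr
    rw [abs_le]; constructor <;> linarith
  have h6 : (γ - ε) * Real.log ‖b‖ = (γ - ε) * Real.log R + (γ - ε) * (Real.log 17 - Real.log 10) := by
    rw [hlR]; ring
  have h7 : K - kernelMean φ R 0 ≤ ε / 400 * Real.log R + C + C' := by linarith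
  linarith

end mass

/-! ### Integration over the fibres of the Hartogs domain -/

section hartogs

variable {N : ℕ} (n : Fin N → ℕ)

lemma enorm_monomial_smul (E : ℝ) (w : Fin N → ℂ) :
    ‖∏ i, (E • w) i ^ n i‖ₑ = ‖E‖ₑ ^ (∑ i, n i) * ‖∏ i, w i ^ n i‖ₑ := by
  have : ∏ i, (E • w) i ^ n i = (E : ℂ) ^ (∑ i, n i) * ∏ i, w i ^ n i := by
    simp only [Pi.smul_apply, Complex.real_smul, mul_pow, Finset.prod_mul_distrib,
      Finset.prod_pow_eq_pow_sum]
  rw [this, enorm_mul, enorm_pow]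
  congr 2
  rw [← ofReal_norm, ← ofReal_norm, Complex.norm_real]

/-- The square of the norm of a monomial in the unit polydisc. -/
noncomputable def monomialMass : ℝ≥0∞ :=
  ∫⁻ w in Metric.ball (0 : Fin N → ℂ) 1, ‖∏ i, w i ^ n i‖ₑ ^ 2

lemma monomialMass_ne_top : monomialMass n ≠ ⊤ := by
  have h : monomialMass n ≤ ∫⁻ w in Metric.ball (0 : Fin N → ℂ) 1, 1 := by
    refine setLIntegral_mono' Metric.isOpen_ball.measurableSet fun w hw => ?_
    have hw' : ‖w‖ < 1 := by simpa using hw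
    refine pow_le_one₀ (by simp) ?_
    rw [← ofReal_norm, ← ENNReal.ofReal_one]
    refine ENNReal.ofReal_le_ofReal ?_
    rw [norm_prod]
    refine Finset.prod_le_one (fun i _ => norm_nonneg _) fun i _ => ?_
    rw [norm_pow]
    exact pow_le_one₀ (norm_nonneg _) ((norm_le_pi_norm w i).trans hw'.le)
  refine ne_top_of_le_ne_top ?_ h
  rw [setLIntegral_one]
  exact measure_ball_lt_top.ne

lemma monomialMass_ne_zero : monomialMass n ≠ 0 := by
  rw [monomialMass, ← lintegral_indicator Metric.isOpen_ball.measurableSet]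
  have hm : Measurable fun w : Fin N → ℂ => ‖∏ i, w i ^ n i‖ₑ ^ 2 := by fun_prop
  rw [Ne, lintegral_eq_zero_iff (hm.indicator Metric.isOpen_ball.measurableSet)]
  intro h
  set U : Set (Fin N → ℂ) := Metric.ball 0 1 ∩ {w | ∏ i, w i ^ n i ≠ 0} with hU
  have hUo : IsOpen U := by
    refine Metric.isOpen_ball.inter (isOpen_ne_fun ?_ continuous_const)
    fun_prop
  have hUn : U.Nonempty := by
    refine ⟨fun _ => 1 / 2, ?_, ?_⟩
    · rw [mem_ball_zero_iff]
      refine lt_of_le_of_lt (pi_norm_const_le _) (by norm_num)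
    · simp [Finset.prod_eq_zero_iff]
  have h2 : volume U = 0 := by
    refine measure_mono_null (fun w hw => ?_) (ae_iff.1 h)
    simp only [Set.mem_ofPred_eq, Set.indicator_of_mem hw.1]
    simpa using hw.2
  exact (hUo.measure_pos volume hUn).ne' h2

/-- Under `w ↦ E w` the Jacobian contributes `E^{2N}` and the squared monomial `E^{2|n|}`. -/
lemma lintegral_monomial_ball {E : ℝ} (hE : 0 < E) :
    ∫⁻ w in Metric.ball (0 : Fin N → ℂ) E, ‖∏ i, w i ^ n i‖ₑ ^ 2
      = ENNReal.ofReal (E ^ (2 * (N + ∑ i, n i))) * monomialMass n := by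
  have hm : Measurable fun w : Fin N → ℂ => ‖∏ i, w i ^ n i‖ₑ ^ 2 := by fun_prop
  have hsm : Measurable fun w : Fin N → ℂ => E • w := by fun_prop
  have hvol := Measure.map_addHaar_smul (volume : Measure (Fin N → ℂ)) hE.ne'
  have hfr : Module.finrank ℝ (Fin N → ℂ) = 2 * N := by
    rw [Module.finrank_pi_fintype]; simp [Complex.finrank_real_complex, mul_comm]
  rw [hfr] at hvol
  have hg := hm.indicator (s := Metric.ball (0 : Fin N → ℂ) E) Metric.isOpen_ball.measurableSet
  have e1 := lintegral_map (μ := volume) hg hsm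
  rw [hvol, lintegral_smul_measure, lintegral_indicator Metric.isOpen_ball.measurableSet] at e1
  have e2 : ∀ w : Fin N → ℂ, (Metric.ball (0 : Fin N → ℂ) E).indicator
      (fun w => ‖∏ i, w i ^ n i‖ₑ ^ 2) (E • w) = ENNReal.ofReal (E ^ (2 * ∑ i, n i)) *
        (Metric.ball (0 : Fin N → ℂ) 1).indicator (fun w => ‖∏ i, w i ^ n i‖ₑ ^ 2) w := by
    intro w
    have hiff : E • w ∈ Metric.ball (0 : Fin N → ℂ) E ↔ w ∈ Metric.ball (0 : Fin N → ℂ) 1 := by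
      rw [mem_ball_zero_iff, mem_ball_zero_iff, norm_smul, Real.norm_of_nonneg hE.le]
      exact ⟨fun h => by nlinarith, fun h => by nlinarith⟩
    by_cases hw : w ∈ Metric.ball (0 : Fin N → ℂ) 1
    · rw [Set.indicator_of_mem (hiff.2 hw), Set.indicator_of_mem hw, enorm_monomial_smul,
        mul_pow, ← pow_mul, Real.enorm_of_nonneg hE.le, ← ENNReal.ofReal_pow hE.le, mul_comm 2]
    · rw [Set.indicator_of_notMem fun h => hw (hiff.1 h), Set.indicator_of_notMem hw, mul_zero]
  simp only [e2] at e1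
  rw [lintegral_const_mul _ (hm.indicator Metric.isOpen_ball.measurableSet),
    lintegral_indicator Metric.isOpen_ball.measurableSet] at e1
  have hpos : 0 < E ^ (2 * N) := by positivity
  have e3 := congrArg (fun x => ENNReal.ofReal (E ^ (2 * N)) * x) e1
  simp only [smul_eq_mul] at e3
  rw [← mul_assoc, ← mul_assoc, ← ENNReal.ofReal_mul hpos.le, ← ENNReal.ofReal_mul hpos.le,
    abs_of_pos (by positivity), mul_inv_cancel₀ hpos.ne', ENNReal.ofReal_one, one_mul,
    ← pow_add, ← mul_add] at e3
  exact e3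

lemma measurableSet_hartogsDomain {φ : ℂ → EReal} (hφ : Measurable φ) :
    MeasurableSet (hartogsDomain N φ) := by
  refine measurableSet_lt (by fun_prop) ?_
  exact EReal.exp_monotone.measurable.comp (hφ.comp measurable_fst).neg

/-- The reduction to a weighted `L²` condition on the plane. -/
lemma isBergmanCoefficient_iff {φ : ℂ → EReal} (hφ : IsSubharmonic φ) (hne : ∃ z, φ z ≠ ⊥)
    (f : ℂ → ℂ) :
    IsBergmanCoefficient φ n f ↔ Differentiable ℂ f ∧ f ≠ 0 ∧
      ∫⁻ z, ENNReal.ofReal (‖f z‖ ^ 2) *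
        ENNReal.ofReal (Real.exp (-(2 * ((N : ℝ) + ∑ i, (n i : ℝ))) * (φ z).toReal)) < ⊤ := by
  refine and_congr_right fun hf => and_congr_right fun _ => ?_
  have hfm : Measurable f := hf.continuous.measurable
  have hDm := measurableSet_hartogsDomain (N := N) hφ.measurable
  have hd : DifferentiableOn ℂ (fun p : ℂ × (Fin N → ℂ) => f p.1 * ∏ i, p.2 i ^ n i)
      (hartogsDomain N φ) := by
    refine Differentiable.differentiableOn ?_
    have h1 : Differentiable ℂ fun p : ℂ × (Fin N → ℂ) => f p.1 := hf.comp differentiable_fst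
    have h2 : ∀ i, Differentiable ℂ fun p : ℂ × (Fin N → ℂ) => p.2 i ^ n i := fun i => by fun_prop
    have h3 : ∀ s : Finset (Fin N),
        Differentiable ℂ fun p : ℂ × (Fin N → ℂ) => ∏ i ∈ s, p.2 i ^ n i := by
      intro s
      induction s using Finset.cons_induction with
      | empty => simp
      | cons i s hi ih =>
        simp only [Finset.prod_cons]
        exact (h2 i).mul ih
    exact h1.mul (h3 _)
  have hFm : Measurable fun p : ℂ × (Fin N → ℂ) => f p.1 * ∏ i, p.2 i ^ n i := by fun_prop
  rw [MemBergman, and_iff_right hd, MemLp, and_iff_right hFm.aestronglyMeasurable,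
    eLpNorm_lt_top_iff_lintegral_rpow_enorm_lt_top (by simp) (by simp),
    ← lintegral_indicator hDm, Measure.volume_eq_prod, lintegral_prod]
  swap
  · exact (Measurable.indicator (by fun_prop) hDm).aemeasurable
  have key : ∫⁻ z, ∫⁻ w, (hartogsDomain N φ).indicator
      (fun p => ‖f p.1 * ∏ i, p.2 i ^ n i‖ₑ ^ (2 : ℝ≥0∞).toReal) (z, w)
      = ∫⁻ z, (ENNReal.ofReal (‖f z‖ ^ 2) *
        ENNReal.ofReal (Real.exp (-(2 * ((N : ℝ) + ∑ i, (n i : ℝ))) * (φ z).toReal)))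
        * monomialMass n := by
    refine lintegral_congr_ae ?_
    filter_upwards [hφ.ae_eq_toReal hne] with z hz
    set x := (φ z).toReal
    have hfib : ∀ w, (hartogsDomain N φ).indicator
      (fun p => ‖f p.1 * ∏ i, p.2 i ^ n i‖ₑ ^ (2 : ℝ≥0∞).toReal) (z, w) =
        ENNReal.ofReal (‖f z‖ ^ 2) * (Metric.ball (0 : Fin N → ℂ) (Real.exp (-x))).indicator
          (fun w => ‖∏ i, w i ^ n i‖ₑ ^ 2) w := by
      intro w
      have hiff : (z, w) ∈ hartogsDomain N φ ↔ w ∈ Metric.ball (0 : Fin N → ℂ) (Real.exp (-x)) := by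
        change ‖w‖ₑ < EReal.exp (-φ z) ↔ _
        rw [hz, ← EReal.coe_neg, EReal.exp_coe, ← ofReal_norm,
          ENNReal.ofReal_lt_ofReal_iff (Real.exp_pos _), mem_ball_zero_iff]
      by_cases hw : w ∈ Metric.ball (0 : Fin N → ℂ) (Real.exp (-x))
      · rw [Set.indicator_of_mem (hiff.2 hw), Set.indicator_of_mem hw, enorm_mul]
        simp only [ENNReal.toReal_ofNat, ENNReal.rpow_ofNat]
        rw [mul_pow, ENNReal.ofReal_pow (norm_nonneg _), ofReal_norm]
      · rw [Set.indicator_of_notMem fun h => hw (hiff.1 h), Set.indicator_of_notMem hw, mul_zero]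
    simp only [hfib]
    rw [lintegral_const_mul _ (Measurable.indicator (by fun_prop) Metric.isOpen_ball.measurableSet),
      lintegral_indicator Metric.isOpen_ball.measurableSet,
      lintegral_monomial_ball n (Real.exp_pos _), mul_assoc]
    congr 3
    rw [← Real.exp_nat_mul]
    congr 1
    push_cast
    ring
  rw [key, lintegral_mul_const, ENNReal.mul_lt_top_iff]
  · simp only [monomialMass_ne_zero, or_false, lt_top_iff_ne_top, Ne, monomialMass_ne_top,
      not_false_eq_true, and_true]
    refine ⟨fun h => h.elim id fun h h' => ENNReal.top_ne_zero (h'.symm.trans h), Or.inl⟩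
  · have := hφ.measurable.ereal_toReal
    fun_prop

end hartogs

/-! ### Entire functions of polynomial growth -/

section entire

/-- An entire function of polynomial growth is a polynomial. -/
lemma exists_polynomial_of_norm_le {f : ℂ → ℂ} (hf : Differentiable ℂ f) {q : ℕ} {C : ℝ}
    (h : ∀ z, ‖f z‖ ≤ C * (1 + ‖z‖) ^ q) : ∃ p : Polynomial ℂ, ∀ z, f z = p.eval z := by
  have hC : 0 ≤ C := by
    have := (norm_nonneg _).trans (h 0)
    simpa using this
  -- Cauchy's estimates on circles of radius `R → ∞`.
  have hz : ∀ m, q < m → iteratedDeriv m f 0 = 0 := by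
    intro m hm
    have hb : ∀ R : ℝ, 1 ≤ R → ‖iteratedDeriv m f 0‖ ≤ m.factorial * (C * 2 ^ q) * R⁻¹ := by
      intro R hR
      have hR0 : 0 < R := by linarith
      have h1 := Complex.norm_iteratedDeriv_le_of_forall_mem_sphere_norm_le m hR0
        (hf.diffContOnCl (s := Metric.ball 0 R)) (C := C * (2 * R) ^ q) (fun z hz => by
          refine (h z).trans ?_
          rw [mem_sphere_zero_iff_norm] at hz
          rw [hz]
          gcongr
          linarith)
      refine h1.trans ?_
      have h2 : R ^ q * R ≤ R ^ m := by
        rw [← pow_succ]; exact pow_le_pow_right₀ hR hm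
      rw [div_le_iff₀ (by positivity), mul_pow]
      calc (m.factorial : ℝ) * (C * (2 ^ q * R ^ q))
          = m.factorial * (C * 2 ^ q) * R⁻¹ * (R ^ q * R) := by field_simp
        _ ≤ _ := by gcongr
    have ht : Tendsto (fun R : ℝ => m.factorial * (C * 2 ^ q) * R⁻¹) atTop (𝓝 0) := by
      simpa using tendsto_inv_atTop_zero.const_mul ((m.factorial : ℝ) * (C * 2 ^ q))
    have := ge_of_tendsto ht ((eventually_ge_atTop 1).mono hb)
    exact norm_le_zero_iff.1 this
  refine ⟨∑ m ∈ Finset.range (q + 1),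
    Polynomial.monomial m ((m.factorial : ℂ)⁻¹ * iteratedDeriv m f 0), fun z => ?_⟩
  have h1 := Complex.hasSum_taylorSeries_of_entire hf 0 z
  have h2 := hasSum_sum_of_ne_finset_zero (L := SummationFilter.unconditional ℕ) (s := Finset.range (q + 1))
    (f := fun m : ℕ => (m.factorial : ℂ)⁻¹ • (z - 0) ^ m • iteratedDeriv m f 0) (fun m hm => by
      rw [hz m (by simpa [Nat.lt_succ_iff] using hm)]; simp)
  rw [h1.unique h2, Polynomial.eval_finsetSum]
  refine Finset.sum_congr rfl fun m _ => ?_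
  simp only [Polynomial.eval_monomial, smul_eq_mul, sub_zero]
  ring

/-- The mean value property of the entire function `f²`, followed by the triangle inequality. -/
lemma enorm_sq_le_lintegral_circle {f : ℂ → ℂ} (hf : Differentiable ℂ f) (b : ℂ) (r : ℝ) :
    ENNReal.ofReal (2 * Real.pi) * ENNReal.ofReal (‖f b‖ ^ 2)
      ≤ ∫⁻ t in Set.Ioc 0 (2 * Real.pi), ENNReal.ofReal (‖f (circleMap b r t)‖ ^ 2) := by
  have hpi := Real.pi_pos
  have h1 : Real.circleAverage (fun z => f z ^ 2) b r = f b ^ 2 :=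
    DiffContOnCl.circleAverage (hf.pow 2).diffContOnCl
  rw [Real.circleAverage_def, intervalIntegral.integral_of_le (by positivity),
    inv_smul_eq_iff₀ (by positivity)] at h1
  have h2 := enorm_integral_le_lintegral_enorm (μ := volume.restrict (Set.Ioc 0 (2 * Real.pi)))
    (fun t => f (circleMap b r t) ^ 2)
  rw [h1, enorm_smul, Real.enorm_of_nonneg (by positivity)] at h2
  have e : ∀ z : ℂ, ‖z ^ 2‖ₑ = ENNReal.ofReal (‖z‖ ^ 2) := fun z => by
    rw [← ofReal_norm, norm_pow]
  simpa only [e] using h2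

lemma enorm_sq_le_lintegral_kernel {f : ℂ → ℂ} (hf : Differentiable ℂ f) {R : ℝ} (hR : 0 < R)
    (b : ℂ) : ENNReal.ofReal (‖f b‖ ^ 2) ≤
      ∫⁻ z, ENNReal.ofReal (annulusKernel R (z - b)) * ENNReal.ofReal (‖f z‖ ^ 2) := by
  have hfm : Measurable f := hf.continuous.measurable
  have hF : Measurable fun r : ℝ =>
      ENNReal.ofReal (profile (Real.log (r / R)) / (2 * Real.pi * r ^ 2)) := by
    have := profile_continuous.measurable
    fun_prop
  have h1 := lintegral_radial_mul hF (v := fun z => ENNReal.ofReal (‖f z‖ ^ 2)) (by fun_prop) b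
  change ∫⁻ z, ENNReal.ofReal (annulusKernel R (z - b)) * _ = _ at h1
  have h2 := lintegral_radial hF b
  change ∫⁻ z, ENNReal.ofReal (annulusKernel R (z - b)) = _ at h2
  rw [lintegral_annulusKernel hR] at h2
  rw [h1, ← one_mul (ENNReal.ofReal (‖f b‖ ^ 2)), h2, mul_comm (ENNReal.ofReal (2 * Real.pi)),
    mul_assoc, ← lintegral_mul_const _ (by fun_prop)]
  refine lintegral_mono fun r => ?_
  gcongr
  exact enorm_sq_le_lintegral_circle hf b r

/-- An entire function that is square integrable with a weight of polynomial decay is a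
polynomial. -/
lemma exists_polynomial_of_lintegral {f : ℂ → ℂ} (hf : Differentiable ℂ f) (q : ℕ)
    (h : ∫⁻ z, ENNReal.ofReal (‖f z‖ ^ 2) * ENNReal.ofReal (((1 + ‖z‖) ^ q)⁻¹) < ⊤) :
    ∃ p : Polynomial ℂ, ∀ z, f z = p.eval z := by
  have hfm : Measurable f := hf.continuous.measurable
  have he : Real.exp 1 < 2.7182818286 := Real.exp_one_lt_d9
  set A := ∫⁻ z, ENNReal.ofReal (‖f z‖ ^ 2) * ENNReal.ofReal (((1 + ‖z‖) ^ q)⁻¹) with hA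
  set c := profileMax / (2 * Real.pi * 1 ^ 2) with hc
  have hc0 : 0 ≤ c := (annulusKernel_nonneg 1 0).trans (annulusKernel_le one_pos 0)
  -- On the support of the unit-scale kernel at `b`, `1 + |z| ≤ 4 (1 + |b|)` because `e < 3`.
  have hb : ∀ b, ‖f b‖ ^ 2 ≤ c * 4 ^ q * A.toReal * (1 + ‖b‖) ^ q := by
    intro b
    have h1 : ENNReal.ofReal (‖f b‖ ^ 2) ≤
        ENNReal.ofReal (c * (4 * (1 + ‖b‖)) ^ q) * A := by
      refine (enorm_sq_le_lintegral_kernel hf one_pos b).trans ?_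
      rw [hA, ← lintegral_const_mul _ (by fun_prop)]
      refine lintegral_mono fun z => ?_
      rw [mul_comm (ENNReal.ofReal (‖f z‖ ^ 2)), ← mul_assoc,
        ← ENNReal.ofReal_mul (show 0 ≤ c * (4 * (1 + ‖b‖)) ^ q by positivity)]
      gcongr
      by_cases hz : z ∈ Metric.closedBall b (Real.exp 1 * 1)
      · refine (annulusKernel_le one_pos _).trans ?_
        rw [← hc, mul_assoc]
        refine le_mul_of_one_le_right hc0 ?_
        rw [← div_eq_mul_inv, one_le_div (by positivity)]
        gcongr
        rw [mem_closedBall_iff_norm] at hz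
        have := norm_add_le (z - b) b
        rw [sub_add_cancel] at this
        linarith [norm_nonneg b]
      · rw [annulusKernel_sub_of_notMem one_pos hz]
        positivity
    have h2 := ENNReal.toReal_mono (ENNReal.mul_ne_top ENNReal.ofReal_ne_top h.ne) h1
    rw [ENNReal.toReal_ofReal (by positivity), ENNReal.toReal_mul,
      ENNReal.toReal_ofReal (by positivity), mul_pow] at h2
    linarith
  refine exists_polynomial_of_norm_le hf (q := q) (C := 1 + c * 4 ^ q * A.toReal) fun z => ?_
  have h1 := hb z
  have hK : 0 ≤ c * 4 ^ q * A.toReal := by positivity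
  have hX : 1 ≤ (1 + ‖z‖) ^ q := one_le_pow₀ (by linarith [norm_nonneg z])
  nlinarith [sq_nonneg (‖f z‖ - 1)]

open Polynomial in
-- `p(z) / z^d` is the reversed polynomial at `1 / z`, which tends to the leading coefficient.
lemma exists_le_norm_eval {p : ℂ[X]} (hp : p ≠ 0) :
    ∃ c > 0, ∃ r : ℝ, 1 ≤ r ∧ ∀ z : ℂ, r ≤ ‖z‖ → c * ‖z‖ ^ p.natDegree ≤ ‖p.eval z‖ := by
  have hlc : 0 < ‖p.leadingCoeff‖ := norm_pos_iff.2 (leadingCoeff_ne_zero.2 hp)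
  have hcont : ContinuousAt (fun z : ℂ => ‖p.reverse.eval z‖) 0 :=
    (p.reverse.continuous.norm).continuousAt
  have h0 : ‖p.reverse.eval 0‖ = ‖p.leadingCoeff‖ := by
    rw [← coeff_zero_eq_eval_zero, coeff_zero_reverse]
  have hev := hcont.eventually (lt_mem_nhds (a := ‖p.leadingCoeff‖ / 2) (by
    change _ < ‖p.reverse.eval 0‖
    rw [h0]; linarith))
  obtain ⟨δ, hδ, hball⟩ := Metric.eventually_nhds_iff_ball.1 hev
  refine ⟨‖p.leadingCoeff‖ / 2, by positivity, max 1 (2 / δ), le_max_left _ _, fun z hz => ?_⟩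
  have hz1 : 1 ≤ ‖z‖ := (le_max_left _ _).trans hz
  have hz2 : 2 / δ ≤ ‖z‖ := (le_max_right _ _).trans hz
  have hz0 : z ≠ 0 := norm_pos_iff.1 (by linarith)
  have := invertibleOfNonzero hz0
  have h1 := eval₂_reverse_mul_pow (RingHom.id ℂ) z p
  rw [invOf_eq_inv] at h1
  change p.reverse.eval z⁻¹ * z ^ p.natDegree = p.eval z at h1
  rw [← h1, norm_mul, norm_pow]
  gcongr
  refine (hball _ ?_).le
  rw [mem_ball_zero_iff, norm_inv, inv_lt_comm₀ (by linarith) hδ]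
  rw [div_le_iff₀ hδ] at hz2
  rw [inv_lt_iff_one_lt_mul₀ hδ]
  linarith

open Polynomial in
lemma exists_le_norm_eval_near {p : ℂ[X]} (hp : p ≠ 0) (a : ℂ) :
    ∃ c > 0, ∃ δ > 0, ∀ z : ℂ, ‖z - a‖ < δ →
      c * ‖z - a‖ ^ p.rootMultiplicity a ≤ ‖p.eval z‖ := by
  set s := p /ₘ (X - C a) ^ rootMultiplicity a p with hs
  have hsa : 0 < ‖s.eval a‖ := norm_pos_iff.2 (eval_divByMonic_pow_rootMultiplicity_ne_zero a hp)
  have hcont : ContinuousAt (fun z : ℂ => ‖s.eval z‖) a := (s.continuous.norm).continuousAt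
  have hev := hcont.eventually (lt_mem_nhds (a := ‖s.eval a‖ / 2) (by linarith))
  obtain ⟨δ, hδ, hball⟩ := Metric.eventually_nhds_iff_ball.1 hev
  refine ⟨‖s.eval a‖ / 2, by positivity, δ, hδ, fun z hz => ?_⟩
  have h1 := congrArg (eval z) (pow_mul_divByMonic_rootMultiplicity_eq p a)
  rw [← h1, eval_mul, norm_mul, eval_pow, norm_pow, eval_sub, eval_X, eval_C, mul_comm]
  gcongr
  exact (hball z (by simpa [dist_eq_norm] using hz)).le

end entire

/-! ### Lower bounds on disjoint annuli -/

section annuli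

lemma lintegral_eq_top_of_annuli {g : ℂ → ℝ≥0∞} (b : ℂ) {s : ℕ → ℤ}
    (hs : Function.Injective s) {δ : ℝ≥0∞} (hδ : δ ≠ 0)
    (h : ∀ i, δ ≤ ∫⁻ z in (fun z : ℂ => ‖z - b‖) ⁻¹'
      Set.Ioo (Real.exp (s i)) (Real.exp (s i + 1)), g z) : ∫⁻ z, g z = ⊤ := by
  set A : ℤ → Set ℂ := fun j => (fun z : ℂ => ‖z - b‖) ⁻¹'
    Set.Ioo (Real.exp j) (Real.exp (j + 1))
  have hAm : ∀ j, MeasurableSet (A j) := fun j =>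
    measurableSet_Ioo.preimage (by fun_prop)
  have hdis : Pairwise (Function.onFun Disjoint A) := by
    have key : ∀ i j : ℤ, i < j → Disjoint (A i) (A j) := by
      intro i j hij
      rw [Set.disjoint_left]
      rintro z ⟨-, h1⟩ ⟨h2, -⟩
      have : Real.exp ((i : ℝ) + 1) ≤ Real.exp j := Real.exp_le_exp.2 (by exact_mod_cast hij)
      linarith
    intro i j hij
    rcases lt_or_gt_of_ne hij with h | h
    · exact key i j h
    · exact (key j i h).symm
  rw [eq_top_iff]
  calc (⊤ : ℝ≥0∞) = ∑' _ : ℕ, δ := (ENNReal.tsum_const_eq_top_of_ne_zero hδ).symm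
    _ ≤ ∑' i, ∫⁻ z in A (s i), g z := ENNReal.tsum_le_tsum h
    _ = ∫⁻ z in ⋃ i, A (s i), g z := (lintegral_iUnion (s := fun i => A (s i)) (fun i => hAm _)
        (fun i j hij => hdis (i := s i) (j := s j) fun h => hij (hs h)) _).symm
    _ ≤ ∫⁻ z, g z := setLIntegral_le_lintegral _ _

variable {φ : ℂ → EReal} (hφ : IsSubharmonic φ) (hne : ∃ z, φ z ≠ ⊥)
include hφ hne

/-- Jensen's inequality for the kernel of scale `R`, combined with the supremum bound `profileMax /
(2πR²)` of that kernel. -/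
lemma le_lintegral_annulus {R : ℝ} (hR : 0 < R) (b : ℂ) (t : ℝ) {F : ℂ → ℝ} {L : ℝ} (hL : 0 < L)
    (hF : ∀ z, R < ‖z - b‖ → ‖z - b‖ < Real.exp 1 * R → L ≤ F z) :
    ENNReal.ofReal (L * (2 * Real.pi * R ^ 2 / profileMax) *
        Real.exp (-t * kernelMean φ R b)) ≤
      ∫⁻ z in (fun z : ℂ => ‖z - b‖) ⁻¹' Set.Ioo R (Real.exp 1 * R),
        ENNReal.ofReal (F z) * ENNReal.ofReal (Real.exp (-t * (φ z).toReal)) := by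
  have hpi := Real.pi_pos
  have hpm := profileMax_pos
  have hAm : MeasurableSet ((fun z : ℂ => ‖z - b‖) ⁻¹' Set.Ioo R (Real.exp 1 * R)) :=
    measurableSet_Ioo.preimage (by fun_prop)
  have hum := hφ.measurable.ereal_toReal
  have hkm : Measurable (annulusKernel R) := (annulusKernel_continuous hR).measurable
  rw [ENNReal.ofReal_mul (by positivity)]
  refine (mul_le_mul_right (hφ.ofReal_exp_le_lintegral hne hR b t) _).trans ?_
  rw [← lintegral_const_mul _ (by fun_prop), ← lintegral_indicator hAm]
  refine lintegral_mono fun z => ?_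
  by_cases hz : z ∈ (fun z : ℂ => ‖z - b‖) ⁻¹' Set.Ioo R (Real.exp 1 * R)
  · rw [Set.indicator_of_mem hz, ← mul_assoc, ← ENNReal.ofReal_mul (by positivity)]
    gcongr
    refine le_trans ?_ (hF z hz.1 hz.2)
    calc L * (2 * Real.pi * R ^ 2 / profileMax) * annulusKernel R (z - b)
        ≤ L * (2 * Real.pi * R ^ 2 / profileMax) * (profileMax / (2 * Real.pi * R ^ 2)) := by
          gcongr
          exact annulusKernel_le hR _
      _ = L := by field_simp
  · have : annulusKernel R (z - b) = 0 := by
      simp only [Set.mem_preimage, Set.mem_Ioo, not_and_or, not_lt] at hz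
      exact hz.elim (annulusKernel_of_norm_le hR) (annulusKernel_of_le_norm hR)
    simp [this]

end annuli

/-! ### Necessary conditions on degree and root multiplicities -/

section necessity

variable {φ : ℂ → EReal} (hφ : IsSubharmonic φ) {γ : ℝ} (hγ : 0 ≤ γ)
  (hlim : limsup (fun z : ℂ => φ z / (Real.log ‖z‖ : EReal)) (Bornology.cobounded ℂ)
      = (γ : EReal))

include hφ hγ hlim

/-- The upper bound `φ ≤ c log⁺ |z| + C` makes the weight decay at most polynomially. A natural
number `c > γ` keeps the exponent natural. -/
lemma exists_polynomial_of_weighted {f : ℂ → ℂ} (hf : Differentiable ℂ f) (k : ℕ)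
    (h : ∫⁻ z, ENNReal.ofReal (‖f z‖ ^ 2) *
      ENNReal.ofReal (Real.exp (-(2 * (k : ℝ)) * (φ z).toReal)) < ⊤) :
    ∃ p : Polynomial ℂ, ∀ z, f z = p.eval z := by
  have hfm : Measurable f := hf.continuous.measurable
  obtain ⟨c, hc⟩ := exists_nat_gt γ
  obtain ⟨C, hC, hb⟩ := exists_le_of_limsup hφ hlim hc (hγ.trans hc.le)
  refine exists_polynomial_of_lintegral hf (2 * k * c) ?_
  have hw : ∀ z, ((1 + ‖z‖) ^ (2 * k * c))⁻¹
      ≤ Real.exp (2 * k * C) * Real.exp (-(2 * (k : ℝ)) * (φ z).toReal) := by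
    intro z
    have hpl : 0 ≤ Real.posLog ‖z‖ := Real.posLog_nonneg
    have hu : (φ z).toReal ≤ c * Real.posLog ‖z‖ + C := by
      rcases eq_or_ne (φ z) ⊥ with h0 | h0
      · rw [h0, EReal.toReal_bot]; positivity
      · rw [← EReal.coe_le_coe_iff, EReal.coe_toReal (hφ.lt_top z).ne h0]
        exact hb z
    have h1 : Real.exp (Real.posLog ‖z‖) ≤ 1 + ‖z‖ := by
      rcases le_total ‖z‖ 1 with hz | hz
      · rw [(Real.posLog_eq_zero_iff _).2 (by rwa [abs_norm]), Real.exp_zero]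
        linarith [norm_nonneg z]
      · rw [Real.posLog_eq_log (by rwa [abs_norm]), Real.exp_log (by linarith)]
        linarith
    rw [← Real.exp_add]
    calc ((1 + ‖z‖) ^ (2 * k * c))⁻¹ ≤ (Real.exp (Real.posLog ‖z‖) ^ (2 * k * c))⁻¹ := by gcongr
      _ = Real.exp (-((2 * k * c : ℕ) * Real.posLog ‖z‖)) := by
        rw [← Real.exp_nat_mul, ← Real.exp_neg]
      _ ≤ _ := by
        refine Real.exp_le_exp.2 ?_
        push_cast
        have : (0 : ℝ) ≤ 2 * k := by positivity
        nlinarith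
  have h2 : ∫⁻ z, ENNReal.ofReal (‖f z‖ ^ 2) * ENNReal.ofReal (((1 + ‖z‖) ^ (2 * k * c))⁻¹)
      ≤ ENNReal.ofReal (Real.exp (2 * k * C)) * ∫⁻ z, ENNReal.ofReal (‖f z‖ ^ 2) *
      ENNReal.ofReal (Real.exp (-(2 * (k : ℝ)) * (φ z).toReal)) := by
    have := hφ.measurable.ereal_toReal
    rw [← lintegral_const_mul _ (by fun_prop)]
    refine lintegral_mono fun z => ?_
    rw [mul_left_comm, ← ENNReal.ofReal_mul (Real.exp_pos (2 * k * C)).le]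
    gcongr
    exact hw z
  exact h2.trans_lt (ENNReal.mul_lt_top ENNReal.ofReal_lt_top h)

variable {ρ : Measure ℂ} (hρ : IsRieszMeasure φ ρ)
include hρ

/-- On the annulus of radius `e^x` the integral is at least a constant times `e^{2(d + 1 - kγ)x}`.
If `d + 1 ≥ kγ`, this stays away from zero on infinitely many annuli. -/
lemma natDegree_lt_of_weighted {p : Polynomial ℂ} (hp : p ≠ 0) (k : ℕ)
    (h : ∫⁻ z, ENNReal.ofReal (‖p.eval z‖ ^ 2) *
      ENNReal.ofReal (Real.exp (-(2 * (k : ℝ)) * (φ z).toReal)) < ⊤) :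
    (p.natDegree : ℝ) < k * γ - 1 := by
  have hne := exists_ne_bot_of_limsup hlim
  have hpi := Real.pi_pos
  have hpm := profileMax_pos
  by_contra! hd
  have hM : ρ.real Set.univ ≤ γ := measureReal_univ_le hφ hγ hlim hρ
  have hkM : (k : ℝ) * ρ.real Set.univ ≤ k * γ := by gcongr
  obtain ⟨c, hc, r, hr, hcr⟩ := exists_le_norm_eval hp
  obtain ⟨j, hj⟩ := exists_nat_ge r
  refine h.ne (lintegral_eq_top_of_annuli 0 (s := fun i => (j + i : ℕ))
    (fun a b hab => by simpa using hab)
    (δ := ENNReal.ofReal (c ^ 2 * (2 * Real.pi / profileMax) *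
      Real.exp (-(2 * (k : ℝ)) * kernelMean φ 1 0))) ?_ fun i => ?_)
  · rw [Ne, ENNReal.ofReal_eq_zero, not_le]; positivity
  · set x : ℝ := ((j + i : ℕ) : ℝ) with hx
    have hx0 : 0 ≤ x := by positivity
    have hxj : r ≤ Real.exp x := by
      have := Real.add_one_le_exp x
      have : (j : ℝ) ≤ x := by rw [hx]; push_cast; linarith [(Nat.cast_nonneg i : (0 : ℝ) ≤ i)]
      linarith
    have key := le_lintegral_annulus hφ hne (Real.exp_pos x) 0 (2 * (k : ℝ))
      (F := fun z => ‖p.eval z‖ ^ 2) (L := (c * Real.exp x ^ p.natDegree) ^ 2) (by positivity)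
      (fun z hz _ => by
        rw [sub_zero] at hz
        have := hcr z (hxj.trans hz.le)
        refine pow_le_pow_left₀ (by positivity) (le_trans ?_ this) 2
        gcongr)
    rw [← Real.exp_add, add_comm 1 x] at key
    refine le_trans (ENNReal.ofReal_le_ofReal ?_) key
    have hk := kernelMean_zero_le hφ hγ hlim hρ (Real.one_le_exp hx0)
    rw [Real.log_exp] at hk
    have e1 : (c * Real.exp x ^ p.natDegree) ^ 2 * (2 * Real.pi * Real.exp x ^ 2 / profileMax) *
        Real.exp (-(2 * (k : ℝ)) * kernelMean φ (Real.exp x) 0)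
        = c ^ 2 * (2 * Real.pi / profileMax) * Real.exp (2 * (p.natDegree + 1) * x -
          2 * k * kernelMean φ (Real.exp x) 0) := by
      rw [sub_eq_add_neg, Real.exp_add, show Real.exp (2 * (p.natDegree + 1) * x)
        = (Real.exp x ^ p.natDegree) ^ 2 * Real.exp x ^ 2 by
          rw [← mul_pow, ← pow_succ, ← pow_mul, ← Real.exp_nat_mul]
          congr 1; push_cast; ring]
      rw [neg_mul]
      ring
    rw [e1]
    gcongr
    have h2 : (k : ℝ) * kernelMean φ (Real.exp x) 0
        ≤ k * (kernelMean φ 1 0 + ρ.real Set.univ * x) := by gcongr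
    nlinarith

omit hγ in
-- The same divergence on annuli shrinking to `a`: if `m + 1 ≤ kρ{a}`, the lower bound `e^{2(m + 1 -
-- kρ{a})x}`, up to a constant, does not decay as `x → -∞`.
lemma floor_le_rootMultiplicity {p : Polynomial ℂ} (hp : p ≠ 0) (k : ℕ)
    (h : ∫⁻ z, ENNReal.ofReal (‖p.eval z‖ ^ 2) *
      ENNReal.ofReal (Real.exp (-(2 * (k : ℝ)) * (φ z).toReal)) < ⊤) (a : ℂ) :
    ⌊(k : ℝ) * ρ.real {a}⌋₊ ≤ p.rootMultiplicity a := by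
  have hne := exists_ne_bot_of_limsup hlim
  have hpi := Real.pi_pos
  have hpm := profileMax_pos
  by_contra! hd
  set m := p.rootMultiplicity a
  have hm : (m : ℝ) + 1 ≤ k * ρ.real {a} := by
    have := (Nat.le_floor_iff (by positivity)).1 (Nat.succ_le_of_lt hd)
    exact_mod_cast this
  obtain ⟨c, hc, δ, hδ, hcr⟩ := exists_le_norm_eval_near hp a
  -- With this choice the outer radius `e · e^{-j}` is at most `δ`.
  obtain ⟨j, hj⟩ := exists_nat_ge (1 - Real.log δ)
  refine h.ne (lintegral_eq_top_of_annuli a (s := fun i => -(j + i : ℕ))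
    (fun a b hab => by simpa using hab)
    (δ := ENNReal.ofReal (c ^ 2 * (2 * Real.pi / profileMax) *
      Real.exp (-(2 * (k : ℝ)) * kernelMean φ 1 a))) ?_ fun i => ?_)
  · rw [Ne, ENNReal.ofReal_eq_zero, not_le]; positivity
  · rw [Int.cast_neg, Int.cast_natCast]
    set x : ℝ := -((j + i : ℕ) : ℝ) with hx
    have hx0 : x ≤ 0 := by rw [hx, neg_nonpos]; positivity
    have hxj : Real.exp 1 * Real.exp x ≤ δ := by
      rw [← Real.exp_add, ← Real.le_log_iff_exp_le hδ]
      have : x ≤ -(j : ℝ) := by rw [hx]; push_cast; linarith [(Nat.cast_nonneg i : (0 : ℝ) ≤ i)]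
      linarith
    have key := le_lintegral_annulus hφ hne (Real.exp_pos x) a (2 * (k : ℝ))
      (F := fun z => ‖p.eval z‖ ^ 2) (L := (c * Real.exp x ^ m) ^ 2) (by positivity)
      (fun z hz hz2 => by
        have := hcr z (hz2.trans_le hxj)
        refine pow_le_pow_left₀ (by positivity) (le_trans ?_ this) 2
        gcongr)
    rw [← Real.exp_add, add_comm 1 x] at key
    refine le_trans (ENNReal.ofReal_le_ofReal ?_) key
    have hk := hφ.kernelMean_le_of_singleton hne hρ (Real.exp_pos x) (Real.exp_le_one_iff.2 hx0) a
    rw [Real.log_exp] at hk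
    have e1 : (c * Real.exp x ^ m) ^ 2 * (2 * Real.pi * Real.exp x ^ 2 / profileMax) *
        Real.exp (-(2 * (k : ℝ)) * kernelMean φ (Real.exp x) a)
        = c ^ 2 * (2 * Real.pi / profileMax) * Real.exp (2 * (m + 1) * x -
          2 * k * kernelMean φ (Real.exp x) a) := by
      rw [sub_eq_add_neg, Real.exp_add, show Real.exp (2 * ((m : ℝ) + 1) * x)
        = (Real.exp x ^ m) ^ 2 * Real.exp x ^ 2 by
          rw [← mul_pow, ← pow_succ, ← pow_mul, ← Real.exp_nat_mul]
          congr 1; push_cast; ring]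
      rw [neg_mul]
      ring
    rw [e1]
    gcongr
    have h2 : (k : ℝ) * kernelMean φ (Real.exp x) a
        ≤ k * (kernelMean φ 1 a + ρ.real {a} * x) := by gcongr
    nlinarith

end necessity

/-! ### Jensen's inequality for small measures -/

section jensen

/-- Jensen's inequality for a measure of mass at most `δ`. -/
lemma ofReal_exp_integral_le {ν : Measure ℂ} [IsFiniteMeasure ν] {g : ℂ → ℝ} (hgm : Measurable g)
    (hg : Integrable g ν) {t δ : ℝ} (hδ : 0 < δ) (hν : ν.real Set.univ ≤ δ) :
    ENNReal.ofReal (Real.exp (t * ∫ w, g w ∂ν)) ≤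
      1 + ENNReal.ofReal δ⁻¹ * ∫⁻ w, ENNReal.ofReal (Real.exp (t * δ * g w)) ∂ν := by
  by_cases hfin : ∫⁻ w, ENNReal.ofReal (Real.exp (t * δ * g w)) ∂ν = ⊤
  · rw [hfin, ENNReal.mul_top (by simpa using hδ)]; simp
  have hi : Integrable (fun w => Real.exp (t * δ * g w)) ν := by
    refine ⟨by fun_prop, ?_⟩
    rw [hasFiniteIntegral_iff_ofReal (ae_of_all _ fun w => (Real.exp_pos _).le)]
    exact lt_top_iff_ne_top.2 hfin
  set x := t * ∫ w, g w ∂ν with hx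
  have h1 : ∫ w, Real.exp x * (1 - x + t * δ * g w) ∂ν
      ≤ ∫ w, Real.exp (t * δ * g w) ∂ν := by
    refine integral_mono (((integrable_const _).add (hg.const_mul _)).const_mul _) hi fun w => ?_
    have h2 := Real.add_one_le_exp (t * δ * g w - x)
    calc Real.exp x * (1 - x + t * δ * g w) = Real.exp x * (t * δ * g w - x + 1) := by ring
      _ ≤ Real.exp x * Real.exp (t * δ * g w - x) := by gcongr
      _ = Real.exp (t * δ * g w) := by rw [← Real.exp_add]; congr 1; ring
  rw [integral_const_mul, integral_add (integrable_const _) (hg.const_mul _), integral_const,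
    integral_const_mul, smul_eq_mul] at h1
  -- Controls the error from the missing mass `δ - ν(ℂ)`; this is the source of the summand `1`.
  have h3 : (1 - x) * Real.exp x ≤ 1 := by
    have := Real.add_one_le_exp (-x)
    calc (1 - x) * Real.exp x ≤ Real.exp (-x) * Real.exp x := by gcongr; linarith
      _ = 1 := by rw [← Real.exp_add]; simp
  have h4 : Real.exp x ≤ 1 + δ⁻¹ * ∫ w, Real.exp (t * δ * g w) ∂ν := by
    have h5 : δ * Real.exp x ≤ δ + ∫ w, Real.exp (t * δ * g w) ∂ν := by
      have h6 := mul_le_mul_of_nonneg_left h3 (sub_nonneg.2 hν)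
      have h7 : (0 : ℝ) ≤ ν.real Set.univ := measureReal_nonneg
      have h8 : t * δ * ∫ w, g w ∂ν = δ * x := by rw [hx]; ring
      rw [h8] at h1
      nlinarith
    calc Real.exp x = δ⁻¹ * (δ * Real.exp x) := by field_simp
      _ ≤ δ⁻¹ * (δ + ∫ w, Real.exp (t * δ * g w) ∂ν) := by gcongr
      _ = _ := by field_simp
  refine (ENNReal.ofReal_le_ofReal h4).trans ?_
  rw [ENNReal.ofReal_add zero_le_one (mul_nonneg (by positivity)
    (integral_nonneg fun w => (Real.exp_pos _).le)), ENNReal.ofReal_one,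
    ENNReal.ofReal_mul (by positivity), ofReal_integral_eq_lintegral_ofReal hi
      (ae_of_all _ fun w => (Real.exp_pos _).le)]

end jensen

/-! ### Integrability of power singularities -/

section singular

lemma measurable_posLog : Measurable Real.posLog := by
  unfold Real.posLog; fun_prop

lemma posLog_div_eq_zero {B s : ℝ} (hB : 0 < B) (h : B ≤ s) : Real.posLog (B / s) = 0 := by
  have hs := hB.trans_le h
  rw [Real.posLog_eq_zero_iff, abs_of_pos (by positivity)]
  exact (div_le_one hs).2 h

lemma posLog_div_eq_log {B s : ℝ} (hs : 0 < s) (h : s ≤ B) :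
    Real.posLog (B / s) = Real.log (B / s) := by
  have hB := hs.trans_le h
  rw [Real.posLog_eq_log]
  rw [abs_of_pos (by positivity)]
  exact (one_le_div hs).2 h

/-- The integral of the singularity `(B / |z|) ^ σ` over the disc of radius `B`. -/
noncomputable def singularMass (B σ : ℝ) : ℝ≥0∞ :=
  ∫⁻ z in Metric.ball (0 : ℂ) B, ENNReal.ofReal (Real.exp (σ * Real.posLog (B / ‖z‖)))

/-- In polar coordinates the integrand is a multiple of `r^{1 - σ}`, integrable at zero for `σ < 2`.
-/
lemma singularMass_lt_top {B σ : ℝ} (hB : 0 < B) (hσ : σ < 2) : singularMass B σ < ⊤ := by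
  have hm := measurable_posLog
  set F : ℝ → ℝ≥0∞ := (Set.Iio B).indicator
    fun s => ENNReal.ofReal (Real.exp (σ * Real.posLog (B / s))) with hF
  have hFm : Measurable F := Measurable.indicator (by fun_prop) measurableSet_Iio
  have h1 := lintegral_radial hFm 0
  have e1 : singularMass B σ = ∫⁻ z : ℂ, F ‖z - 0‖ := by
    rw [singularMass, ← lintegral_indicator Metric.isOpen_ball.measurableSet]
    refine lintegral_congr fun z => ?_
    by_cases hz : z ∈ Metric.ball (0 : ℂ) B
    · have : ‖z‖ ∈ Set.Iio B := mem_ball_zero_iff.1 hz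
      rw [Set.indicator_of_mem hz, sub_zero, hF, Set.indicator_of_mem this]
    · have : ‖z‖ ∉ Set.Iio B := fun h => hz (mem_ball_zero_iff.2 h)
      rw [Set.indicator_of_notMem hz, sub_zero, hF, Set.indicator_of_notMem this]
  rw [e1, h1]
  refine ENNReal.mul_lt_top ENNReal.ofReal_lt_top ?_
  have h2 : ∫⁻ r in Set.Ioi (0 : ℝ), ENNReal.ofReal r * F r
      ≤ ∫⁻ r in Set.Ioc (0 : ℝ) B, ENNReal.ofReal (B ^ σ * r ^ (1 - σ)) := by
    rw [← lintegral_indicator measurableSet_Ioi, ← lintegral_indicator measurableSet_Ioc]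
    refine lintegral_mono fun r => ?_
    by_cases hr : r ∈ Set.Ioi (0 : ℝ)
    · rw [Set.indicator_of_mem hr]
      have hr' : 0 < r := hr
      by_cases hrB : r < B
      · rw [Set.indicator_of_mem (show r ∈ Set.Ioc 0 B from ⟨hr', hrB.le⟩), hF,
          Set.indicator_of_mem (show r ∈ Set.Iio B from hrB), ← ENNReal.ofReal_mul hr'.le,
          posLog_div_eq_log hr' hrB.le]
        refine ENNReal.ofReal_le_ofReal (le_of_eq ?_)
        rw [mul_comm σ, Real.exp_mul, Real.exp_log (by positivity), Real.div_rpow hB.le hr'.le,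
          Real.rpow_sub hr', Real.rpow_one]
        ring
      · rw [hF, Set.indicator_of_notMem (show r ∉ Set.Iio B from hrB), mul_zero]
        exact zero_le
    · rw [Set.indicator_of_notMem hr]; exact zero_le
  refine h2.trans_lt ?_
  have h3 : IntegrableOn (fun r : ℝ => B ^ σ * r ^ (1 - σ)) (Set.Ioc 0 B) := by
    have := (intervalIntegral.intervalIntegrable_rpow' (a := 0) (b := B) (r := 1 - σ)
      (by linarith)).const_mul (B ^ σ)
    exact (intervalIntegrable_iff_integrableOn_Ioc_of_le hB.le).1 this
  have h4 := h3.2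
  rwa [hasFiniteIntegral_iff_ofReal] at h4
  refine (ae_restrict_iff' measurableSet_Ioc).2 (ae_of_all _ fun r hr => ?_)
  have : 0 < r := hr.1
  simp only [Pi.zero_apply]
  positivity

/-- Beyond distance `B` from `w` the truncated logarithm vanishes; closer, `Φ ≤ 1` and translation
invariance apply. The bound is uniform in `w`, as Tonelli's theorem will require. -/
lemma setLIntegral_singular_le {B σ : ℝ} (hB : 0 < B) (G : Set ℂ) (w : ℂ) {Φ : ℂ → ℝ≥0∞}
    (hΦm : Measurable Φ) (hΦ : ∀ z ∈ G, Φ z ≤ 1) (hG : MeasurableSet G) :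
    ∫⁻ z in G, Φ z * ENNReal.ofReal (Real.exp (σ * Real.posLog (B / ‖w - z‖)))
      ≤ (∫⁻ z in G, Φ z) + singularMass B σ := by
  have hm := measurable_posLog
  have e1 : singularMass B σ = ∫⁻ z, (Metric.ball (0 : ℂ) B).indicator
      (fun z => ENNReal.ofReal (Real.exp (σ * Real.posLog (B / ‖z‖)))) (z - w) := by
    rw [lintegral_sub_right_eq_self (fun z => (Metric.ball (0 : ℂ) B).indicator
      (fun z => ENNReal.ofReal (Real.exp (σ * Real.posLog (B / ‖z‖)))) z) w,
      lintegral_indicator Metric.isOpen_ball.measurableSet, singularMass]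
  rw [e1]
  refine le_trans ?_ (add_le_add_right (setLIntegral_le_lintegral G _) _)
  rw [← lintegral_add_left hΦm]
  refine setLIntegral_mono' hG fun z hz => ?_
  by_cases hzw : ‖w - z‖ < B
  · have : z - w ∈ Metric.ball (0 : ℂ) B := by
      rwa [mem_ball_zero_iff, norm_sub_rev]
    rw [Set.indicator_of_mem this, norm_sub_rev z w]
    refine le_add_left ?_
    exact mul_le_of_le_one_left zero_le (hΦ z hz)
  · rw [posLog_div_eq_zero hB (not_lt.1 hzw), mul_zero, Real.exp_zero, ENNReal.ofReal_one, mul_one]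
    exact le_self_add

end singular

/-! ### Pointwise control of the weight by the Riesz potential -/

section lower

variable {φ : ℂ → EReal} (hφ : IsSubharmonic φ) (hne : ∃ z, φ z ≠ ⊥)
  {ρ : Measure ℂ} [IsFiniteMeasure ρ] (hρ : IsRieszMeasure φ ρ)

omit hφ hne hρ in
lemma ae_measure_singleton_eq_zero (ρ : Measure ℂ) [IsFiniteMeasure ρ] :
    ∀ᵐ z : ℂ, ρ {z} = 0 := by
  have h := Measure.countable_meas_pos_of_disjoint_iUnion (μ := ρ) (As := fun z : ℂ => {z})
    (fun z => measurableSet_singleton z) (fun a b hab => by simpa using hab)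
  rw [ae_iff]
  refine measure_mono_null (fun z hz => ?_) (h.measure_zero volume)
  exact pos_iff_ne_zero.2 hz

include hφ hne hρ

/-- Pointwise upper bound of `exp (-t φ)` by the local potential of the Riesz measure, where the
potential of a point `p` is separated from the rest. -/
lemma ofReal_exp_neg_le {R : ℝ} (hR : 0 < R) {z p : ℂ} (hz : ρ {z} = 0)
    (hzφ : φ z = ((φ z).toReal : EReal)) {S : Set ℂ} (hSm : MeasurableSet S)
    (hS : ∀ w, w ∉ S → Real.exp 2 * R ≤ ‖w - z‖) {t δ : ℝ} (ht : 0 < t) (hδ : 0 < δ)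
    (hSδ : ρ.real (S \ {p}) ≤ δ) :
    ENNReal.ofReal (Real.exp (-t * (φ z).toReal)) ≤
      ENNReal.ofReal (Real.exp (-t * kernelMean φ R z +
        t * ρ.real {p} * Real.posLog (Real.exp 2 * R / ‖p - z‖))) *
      (1 + ENNReal.ofReal δ⁻¹ * ∫⁻ w in S \ {p}, ENNReal.ofReal
        (Real.exp (t * δ * Real.posLog (Real.exp 2 * R / ‖w - z‖))) ∂ρ) := by
  have hm := measurable_posLog
  set B := Real.exp 2 * R with hBdef
  have hB : 0 < B := by positivity
  set g : ℂ → ℝ := fun w => Real.posLog (B / ‖w - z‖) with hg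
  have hgm : Measurable g := by fun_prop
  have hg0 : ∀ w, 0 ≤ g w := fun w => Real.posLog_nonneg
  have hSm' : MeasurableSet (S \ {p}) := hSm.diff (measurableSet_singleton p)
  -- If the exponential integral diverges, the right side is infinite. Otherwise `g ≤ e^{tδg} /
  -- (tδ)` makes the potential itself integrable.
  by_cases hfin : ∫⁻ w in S \ {p}, ENNReal.ofReal (Real.exp (t * δ * g w)) ∂ρ = ⊤
  · rw [hfin, ENNReal.mul_top (by simpa using hδ), add_top, ENNReal.mul_top]
    · exact le_top
    · simpa using Real.exp_pos _
  have hi : IntegrableOn g (S \ {p}) ρ := by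
    have hi' : IntegrableOn (fun w => Real.exp (t * δ * g w)) (S \ {p}) ρ := by
      refine ⟨by fun_prop, ?_⟩
      rw [hasFiniteIntegral_iff_ofReal (ae_of_all _ fun w => (Real.exp_pos _).le)]
      exact lt_top_iff_ne_top.2 hfin
    refine (hi'.const_mul (t * δ)⁻¹).mono' hgm.aestronglyMeasurable (ae_of_all _ fun w => ?_)
    rw [Real.norm_of_nonneg (hg0 w)]
    have h1 := Real.add_one_le_exp (t * δ * g w)
    calc g w = (t * δ)⁻¹ * (t * δ * g w) := by field_simp
      _ ≤ (t * δ)⁻¹ * Real.exp (t * δ * g w) := by gcongr; linarith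
  have hi2 : IntegrableOn g ({p} ∪ S) ρ := by
    rw [← Set.union_sdiff_self]
    exact (integrableOn_singleton (by simp) (measure_lt_top ρ {p})).union hi
  have hzero : ∀ w, w ∉ ({p} ∪ S : Set ℂ) → g w = 0 := fun w hw =>
    posLog_div_eq_zero hB (hS w fun h => hw (Or.inr h))
  have hi3 : Integrable g ρ := by
    refine (integrableOn_iff_integrable_of_support_subset fun w hw => ?_).1 hi2
    by_contra h
    exact hw (hzero w h)
  have hsplit : ∫ w, g w ∂ρ = ρ.real {p} * g p + ∫ w in S \ {p}, g w ∂ρ := by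
    rw [← setIntegral_eq_integral_of_forall_compl_eq_zero hzero, ← Set.union_sdiff_self,
      setIntegral_union Set.disjoint_sdiff_right hSm'
        (integrableOn_singleton (by simp) (measure_lt_top ρ {p})) hi,
      integral_singleton, smul_eq_mul]
  have hlow := hφ.kernelMean_sub_le hne hρ hR hz hi3
  rw [hzφ, EReal.coe_le_coe_iff, hsplit] at hlow
  have hj := ofReal_exp_integral_le (ν := ρ.restrict (S \ {p})) hgm hi (t := t) hδ
    (by rwa [measureReal_restrict_apply_univ])
  refine le_trans ?_ (mul_le_mul_right hj _)
  rw [← ENNReal.ofReal_mul (Real.exp_pos _).le, ← Real.exp_add]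
  refine ENNReal.ofReal_le_ofReal (Real.exp_le_exp.2 ?_)
  have := mul_le_mul_of_nonneg_left hlow ht.le
  change t * (kernelMean φ R z - (ρ.real {p} * g p + ∫ w in S \ {p}, g w ∂ρ)) ≤ _ at this
  change _ ≤ -t * kernelMean φ R z + t * ρ.real {p} * g p + t * ∫ w in S \ {p}, g w ∂ρ
  linarith

end lower

/-! ### Local integrability of the weight -/

section sufficiency

variable {φ : ℂ → EReal} (hφ : IsSubharmonic φ) (hne : ∃ z, φ z ≠ ⊥)
  {ρ : Measure ℂ} [IsFiniteMeasure ρ] (hρ : IsRieszMeasure φ ρ)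

omit hφ hne hρ in
/-- A double integral with a uniformly integrable kernel is finite. -/
lemma setLIntegral_mul_one_add_lt_top {G S : Set ℂ} {Φ : ℂ → ℝ≥0∞}
    (hΦm : Measurable Φ) {E : ℂ → ℂ → ℝ≥0∞} (hEm : Measurable fun q : ℂ × ℂ => E q.1 q.2)
    {c A : ℝ≥0∞} (hc : c ≠ ⊤) (hA : A ≠ ⊤) (hΦ : ∫⁻ z in G, Φ z ≠ ⊤)
    (hE : ∀ w, ∫⁻ z in G, Φ z * E z w ≤ A) :
    ∫⁻ z in G, Φ z * (1 + c * ∫⁻ w in S, E z w ∂ρ) < ⊤ := by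
  have hm2 : Measurable fun z => ∫⁻ w in S, E z w ∂ρ :=
    Measurable.lintegral_prod_right' (f := fun q : ℂ × ℂ => E q.1 q.2) hEm
  have hEz : ∀ z, Measurable (E z) := fun z => hEm.comp (by fun_prop : Measurable fun w => (z, w))
  have e : ∀ z, Φ z * (1 + c * ∫⁻ w in S, E z w ∂ρ)
      = Φ z + c * ∫⁻ w in S, Φ z * E z w ∂ρ := by
    intro z
    rw [lintegral_const_mul _ (hEz z)]
    ring
  simp only [e]
  have hjm : Measurable fun q : ℂ × ℂ => Φ q.1 * E q.1 q.2 := by fun_prop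
  have hm3 : Measurable fun z => ∫⁻ w in S, Φ z * E z w ∂ρ :=
    Measurable.lintegral_prod_right' (f := fun q : ℂ × ℂ => Φ q.1 * E q.1 q.2) hjm
  rw [lintegral_add_left hΦm, lintegral_const_mul _ hm3, lintegral_lintegral_swap hjm.aemeasurable]
  refine ENNReal.add_lt_top.2 ⟨hΦ.lt_top, ENNReal.mul_lt_top hc.lt_top ?_⟩
  calc ∫⁻ w in S, (∫⁻ z in G, Φ z * E z w) ∂ρ ≤ ∫⁻ _ in S, A ∂ρ := lintegral_mono fun w => hE w
    _ = A * ρ S := by rw [setLIntegral_const]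
    _ < ⊤ := ENNReal.mul_lt_top hA.lt_top (measure_lt_top ρ S)

omit hφ hne hρ in
lemma exists_ball_diff_measureReal_le (ρ : Measure ℂ) [IsFiniteMeasure ρ] (p : ℂ) {δ : ℝ}
    (hδ : 0 < δ) : ∃ B : ℝ, 0 < B ∧ B ≤ 1 ∧ ρ.real (Metric.ball p (2 * B) \ {p}) ≤ δ := by
  have ht : Tendsto (fun n : ℕ => ρ.real (Metric.ball p (2 * (1 / ((n : ℝ) + 1))) \ {p})) atTop
      (𝓝 (ρ.real (⋂ n : ℕ, Metric.ball p (2 * (1 / ((n : ℝ) + 1))) \ {p}))) := by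
    refine (ENNReal.tendsto_toReal (measure_ne_top _ _)).comp
      (tendsto_measure_iInter_atTop (fun n => ?_) ?_ ⟨0, measure_ne_top _ _⟩)
    · exact (Metric.isOpen_ball.measurableSet.diff (measurableSet_singleton p)).nullMeasurableSet
    · intro m n h
      refine Set.sdiff_subset_sdiff_left (Metric.ball_subset_ball ?_)
      gcongr
  have h0 : (⋂ n : ℕ, Metric.ball p (2 * (1 / ((n : ℝ) + 1))) \ {p}) = ∅ := by
    rw [Set.eq_empty_iff_forall_notMem]
    intro z hz
    rw [Set.mem_iInter] at hz
    have hzp : 0 < dist z p := dist_pos.2 (hz 0).2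
    obtain ⟨n, hn⟩ := exists_nat_one_div_lt (half_pos hzp)
    have := Metric.mem_ball.1 (hz n).1
    linarith
  rw [h0, measureReal_empty] at ht
  obtain ⟨n, hn⟩ := (ht.eventually (gt_mem_nhds hδ)).exists
  refine ⟨1 / ((n : ℝ) + 1), by positivity, ?_, hn.le⟩
  rw [div_le_one (by positivity)]
  linarith [(Nat.cast_nonneg n : (0 : ℝ) ≤ n)]

include hφ hne hρ

/-- Local integrability of `|f|² e^{-2kφ}` when `f` vanishes to sufficient order. -/
lemma exists_ball_setLIntegral_lt_top {f : ℂ → ℂ} (p : ℂ) {k m : ℕ} (hk : 0 < k)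
    (hm : (k : ℝ) * ρ.real {p} < m + 1) {C : ℝ}
    (hf : ∀ z, ‖z - p‖ ≤ 1 → ‖f z‖ ≤ C * ‖z - p‖ ^ m) :
    ∃ B > 0, ∫⁻ z in Metric.ball p B, ENNReal.ofReal (‖f z‖ ^ 2) *
      ENNReal.ofReal (Real.exp (-(2 * (k : ℝ)) * (φ z).toReal)) < ⊤ := by
  have hplm := measurable_posLog
  have hk' : (0 : ℝ) < k := by exact_mod_cast hk
  set t : ℝ := 2 * (k : ℝ) with ht
  have ht0 : 0 < t := by positivity
  -- The exponent left at `p` after the zero of `f` has acted; it is below `2` exactly because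
  -- `kρ{p} < m + 1`.
  set τ : ℝ := max 0 (t * ρ.real {p} - 2 * m) with hτ
  have hτ0 : 0 ≤ τ := le_max_left _ _
  have hτ2 : τ < 2 := max_lt (by norm_num) (by rw [ht]; linarith)
  -- Half of the gap `2 - τ` is granted to the remaining mass, so that `τ + tδ < 2`.
  set δ := (2 - τ) / (2 * t) with hδ
  have hδ0 : 0 < δ := div_pos (by linarith) (by linarith)
  have hσ : τ + t * δ < 2 := by
    have : t * δ = (2 - τ) / 2 := by rw [hδ]; field_simp
    linarith
  set σ := τ + t * δ with hσdef
  obtain ⟨B, hB, hB1, hBδ⟩ := exists_ball_diff_measureReal_le ρ p hδ0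
  refine ⟨B, hB, ?_⟩
  set R := B / Real.exp 2 with hR
  have hR0 : 0 < R := div_pos hB (Real.exp_pos 2)
  have hBR : Real.exp 2 * R = B := by rw [hR]; field_simp
  obtain ⟨T, hT⟩ := hφ.abs_kernelMean_le hne hR0 p B
  set c : ℝ := C ^ 2 * B ^ (2 * m) * Real.exp (t * T) with hc
  have hc0 : 0 ≤ c := by positivity
  set Φ : ℂ → ℝ≥0∞ := fun z => ENNReal.ofReal (Real.exp (τ * Real.posLog (B / ‖p - z‖))) with hΦ
  set E : ℂ → ℂ → ℝ≥0∞ := fun z w =>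
    ENNReal.ofReal (Real.exp (t * δ * Real.posLog (B / ‖w - z‖))) with hE
  have hΦm : Measurable Φ := by fun_prop
  have hEm : Measurable fun q : ℂ × ℂ => E q.1 q.2 := by fun_prop
  have hball : MeasurableSet (Metric.ball p B) := Metric.isOpen_ball.measurableSet
  have hvol : volume (Metric.ball p B) < ⊤ := measure_ball_lt_top
  have hsing : ∀ s < 2, ∀ w, ∫⁻ z in Metric.ball p B,
      ENNReal.ofReal (Real.exp (s * Real.posLog (B / ‖w - z‖)))
        ≤ volume (Metric.ball p B) + singularMass B s := by
    intro s _ w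
    have := setLIntegral_singular_le (σ := s) hB (Metric.ball p B) w (Φ := fun _ => 1)
      measurable_const (fun _ _ => le_rfl) hball
    simpa using this
  have hfin : ∀ s < 2, volume (Metric.ball p B) + singularMass B s ≠ ⊤ := fun s hs =>
    (ENNReal.add_lt_top.2 ⟨hvol, singularMass_lt_top hB hs⟩).ne
  have hΦfin : ∫⁻ z in Metric.ball p B, Φ z ≠ ⊤ :=
    ne_top_of_le_ne_top (hfin τ hτ2) (hsing τ hτ2 p)
  have hEfin : ∀ w, ∫⁻ z in Metric.ball p B, Φ z * E z w
      ≤ (volume (Metric.ball p B) + singularMass B σ)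
        + (volume (Metric.ball p B) + singularMass B σ) := by
    intro w
    refine le_trans ?_ (add_le_add (hsing σ hσ p) (hsing σ hσ w))
    rw [← lintegral_add_left (by fun_prop)]
    refine lintegral_mono fun z => ?_
    simp only [hΦ, hE]
    rw [← ENNReal.ofReal_mul (Real.exp_pos _).le, ← Real.exp_add,
      ← ENNReal.ofReal_add (Real.exp_pos _).le (Real.exp_pos _).le]
    refine ENNReal.ofReal_le_ofReal ?_
    have htδ : 0 ≤ t * δ := by positivity
    -- The product of the two singularities is at most the larger one raised to the combined
    -- exponent `σ`, hence at most the sum of both.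
    rcases le_total (Real.posLog (B / ‖p - z‖)) (Real.posLog (B / ‖w - z‖)) with h | h
    · refine le_add_of_nonneg_of_le (Real.exp_pos _).le (Real.exp_le_exp.2 ?_)
      rw [hσdef]; nlinarith
    · refine le_add_of_le_of_nonneg (Real.exp_le_exp.2 ?_) (Real.exp_pos _).le
      rw [hσdef]; nlinarith
  have key := setLIntegral_mul_one_add_lt_top (ρ := ρ) (S := Metric.ball p (2 * B) \ {p})
    hΦm hEm (c := ENNReal.ofReal δ⁻¹) ENNReal.ofReal_ne_top
    (ENNReal.add_ne_top.2 ⟨hfin σ hσ, hfin σ hσ⟩) hΦfin hEfin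
  refine lt_of_le_of_lt ?_ (ENNReal.mul_lt_top (ENNReal.ofReal_lt_top (r := c)) key)
  have hm2 : Measurable fun z => ∫⁻ w in Metric.ball p (2 * B) \ {p}, E z w ∂ρ :=
    Measurable.lintegral_prod_right' (f := fun q : ℂ × ℂ => E q.1 q.2) hEm
  rw [← lintegral_const_mul _ (by fun_prop)]
  refine lintegral_mono_ae ?_
  have hsg : ∀ᵐ z : ℂ, z ≠ p := by
    rw [ae_iff]; simp
  filter_upwards [ae_restrict_of_ae (hφ.ae_eq_toReal hne), ae_restrict_mem hball,
    ae_restrict_of_ae (ae_measure_singleton_eq_zero ρ), ae_restrict_of_ae hsg] with z hzφ hzB hz hzp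
  have hzB' : ‖z - p‖ < B := mem_ball_iff_norm.1 hzB
  have hz0 : 0 < ‖z - p‖ := norm_pos_iff.2 (sub_ne_zero.2 hzp)
  have hb := ofReal_exp_neg_le hφ hne hρ hR0 (p := p) hz hzφ (S := Metric.ball p (2 * B))
    Metric.isOpen_ball.measurableSet (fun w hw => by
      rw [hBR]
      rw [mem_ball_iff_norm, not_lt] at hw
      have := norm_add_le (w - z) (z - p)
      rw [sub_add_sub_cancel] at this
      linarith) ht0 hδ0 hBδ
  rw [hBR] at hb
  refine (mul_le_mul_right hb _).trans ?_
  rw [← mul_assoc, ← mul_assoc]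
  refine mul_le_mul_left ?_ _
  rw [hΦ, ← ENNReal.ofReal_mul (by positivity), ← ENNReal.ofReal_mul hc0]
  refine ENNReal.ofReal_le_ofReal ?_
  set L := Real.posLog (B / ‖p - z‖) with hL
  have hL0 : 0 ≤ L := Real.posLog_nonneg
  have hLeq : Real.exp (-L) = ‖z - p‖ / B := by
    rw [hL, norm_sub_rev p z, posLog_div_eq_log hz0 hzB'.le, ← Real.log_inv, Real.exp_log
      (by positivity), inv_div]
  have h1 : ‖f z‖ ^ 2 ≤ C ^ 2 * B ^ (2 * m) * Real.exp (-(2 * m) * L) := by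
    have h2 := hf z (hzB'.le.trans hB1)
    have h3 : ‖z - p‖ = B * Real.exp (-L) := by rw [hLeq]; field_simp
    rw [h3] at h2
    calc ‖f z‖ ^ 2 ≤ (C * (B * Real.exp (-L)) ^ m) ^ 2 := by gcongr
      _ = C ^ 2 * B ^ (2 * m) * Real.exp (-L) ^ (2 * m) := by ring
      _ = _ := by
        rw [← Real.exp_nat_mul]; congr 2; push_cast; ring
  have h4 : Real.exp (-t * kernelMean φ R z + t * ρ.real {p} * L)
      ≤ Real.exp (t * T) * Real.exp (t * ρ.real {p} * L) := by
    rw [← Real.exp_add]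
    refine Real.exp_le_exp.2 ?_
    have := neg_le_of_abs_le (hT z (Metric.ball_subset_closedBall hzB))
    nlinarith
  calc ‖f z‖ ^ 2 * Real.exp (-t * kernelMean φ R z + t * ρ.real {p} * L)
      ≤ (C ^ 2 * B ^ (2 * m) * Real.exp (-(2 * m) * L)) *
        (Real.exp (t * T) * Real.exp (t * ρ.real {p} * L)) := by gcongr
    _ = c * Real.exp ((t * ρ.real {p} - 2 * m) * L) := by
      rw [hc, show (t * ρ.real {p} - 2 * m) * L = -(2 * m) * L + t * ρ.real {p} * L by ring,
        Real.exp_add]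
      ring
    _ ≤ c * Real.exp (τ * L) := by
      gcongr
      exact le_max_right _ _

end sufficiency

/-! ### Integrability of the weight near infinity -/

section infinity

lemma setLIntegral_exp_neg_log_lt_top {r q : ℝ} (hr : 1 ≤ r) (hq : 2 < q) :
    ∫⁻ z in (Metric.closedBall (0 : ℂ) r)ᶜ, ENNReal.ofReal (Real.exp (-q * Real.log ‖z‖)) < ⊤ := by
  have h1 : ∫⁻ z : ℂ, ENNReal.ofReal ((1 + ‖z‖) ^ (-q)) < ⊤ :=
    finite_integral_one_add_norm (by rw [Complex.finrank_real_complex]; exact_mod_cast hq)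
  have h2 := ENNReal.mul_lt_top (ENNReal.ofReal_lt_top (r := (2 : ℝ) ^ q)) h1
  refine lt_of_le_of_lt ?_ h2
  rw [← lintegral_const_mul _ (by fun_prop)]
  refine (setLIntegral_mono' Metric.isClosed_closedBall.measurableSet.compl fun z hz => ?_).trans
    (setLIntegral_le_lintegral _ _)
  rw [Set.mem_compl_iff, mem_closedBall_zero_iff, not_le] at hz
  have hz0 : 0 < ‖z‖ := by linarith
  rw [← ENNReal.ofReal_mul (by positivity)]
  refine ENNReal.ofReal_le_ofReal ?_
  rw [mul_comm (-q), Real.exp_mul, Real.exp_log hz0, Real.rpow_neg hz0.le,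
    Real.rpow_neg (by positivity), ← div_eq_mul_inv, ← inv_div,
    ← Real.div_rpow (by positivity) (by norm_num)]
  gcongr
  linarith

variable {φ : ℂ → EReal} (hφ : IsSubharmonic φ) {γ : ℝ} (hγ : 0 ≤ γ)
  (hlim : limsup (fun z : ℂ => φ z / (Real.log ‖z‖ : EReal)) (Bornology.cobounded ℂ)
      = (γ : EReal))
  {ρ : Measure ℂ} (hρ : IsRieszMeasure φ ρ)

include hφ hγ hlim hρ

/-- Integrability of `|f|² e^{-2kφ}` near infinity when `f` has small growth. -/
lemma exists_compl_setLIntegral_lt_top {f : ℂ → ℂ} {k d : ℕ} (hk : 0 < k)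
    (hd : (d : ℝ) < k * γ - 1) {C : ℝ} (hf : ∀ z, 1 ≤ ‖z‖ → ‖f z‖ ≤ C * ‖z‖ ^ d) :
    ∃ r, ∫⁻ z in (Metric.closedBall (0 : ℂ) r)ᶜ, ENNReal.ofReal (‖f z‖ ^ 2) *
      ENNReal.ofReal (Real.exp (-(2 * (k : ℝ)) * (φ z).toReal)) < ⊤ := by
  have hne := exists_ne_bot_of_limsup hlim
  have := isFiniteMeasure_of_limsup hφ hγ hlim hρ
  have hplm := measurable_posLog
  have hk' : (0 : ℝ) < k := by exact_mod_cast hk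
  set t : ℝ := 2 * (k : ℝ) with ht
  have ht0 : 0 < t := by positivity
  -- The decay exponent `2kγ - 2d` exceeds `2` by `2(kγ - 1 - d)`. The losses `tε` and `tδ` use at
  -- most half of this excess.
  set ε : ℝ := (k * γ - 1 - d) / (2 * t) with hε
  have hε0 : 0 < ε := div_pos (by linarith) (by positivity)
  have htε : t * ε = (k * γ - 1 - d) / 2 := by rw [hε]; field_simp
  -- The bound `1 / t` keeps the local singularity exponent `tδ` below `2`.
  set δ : ℝ := min ε (1 / t) with hδ
  have hδ0 : 0 < δ := lt_min hε0 (by positivity)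
  have htδ1 : t * δ ≤ 1 := by
    calc t * δ ≤ t * (1 / t) := by gcongr; exact min_le_right _ _
      _ = 1 := by field_simp
  have htδ2 : t * δ ≤ t * ε := by gcongr; exact min_le_left _ _
  have htδ0 : 0 < t * δ := by positivity
  set q : ℝ := t * (γ - ε) - 2 * d - t * δ with hq
  have hq2 : 2 < q := by
    have : q = 2 * (k * γ) - t * ε - 2 * d - t * δ := by rw [hq, ht]; ring
    linarith
  obtain ⟨T, hT⟩ := le_kernelMean_of_norm hφ hγ hlim hρ hε0
  obtain ⟨s, hs, hsδ⟩ := exists_measureReal_closedBall_gt hφ hγ hlim hρ hδ0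
  set S : Set ℂ := (Metric.closedBall 0 s)ᶜ with hS
  have hSm : MeasurableSet S := Metric.isClosed_closedBall.measurableSet.compl
  have hSδ : ρ.real (S \ {0}) ≤ δ := by
    refine (measureReal_mono Set.sdiff_subset).trans ?_
    rw [hS, measureReal_compl Metric.isClosed_closedBall.measurableSet]
    linarith
  -- `17` is the range of the estimate for the means; `2 s` separates `z` from the disc carrying
  -- almost all the mass.
  set r : ℝ := max 17 (2 * s) with hr
  have hr17 : 17 ≤ r := le_max_left _ _
  have hr2 : 2 * s ≤ r := le_max_right _ _
  refine ⟨r, ?_⟩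
  set G : Set ℂ := (Metric.closedBall 0 r)ᶜ with hG
  have hGm : MeasurableSet G := Metric.isClosed_closedBall.measurableSet.compl
  have hGr : ∀ z ∈ G, r < ‖z‖ := fun z hz => by simpa [hG] using hz
  set Φ : ℂ → ℝ≥0∞ := fun z => ENNReal.ofReal (Real.exp (-q * Real.log ‖z‖)) with hΦ
  set E : ℂ → ℂ → ℝ≥0∞ := fun z w =>
    ENNReal.ofReal (Real.exp (t * δ * Real.posLog (1 / ‖w - z‖))) with hE
  have hΦm : Measurable Φ := by fun_prop
  have hEm : Measurable fun q : ℂ × ℂ => E q.1 q.2 := by fun_prop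
  have hΦfin : ∫⁻ z in G, Φ z < ⊤ := setLIntegral_exp_neg_log_lt_top (by linarith) hq2
  have hΦ1 : ∀ z ∈ G, Φ z ≤ 1 := by
    intro z hz
    have := Real.log_nonneg (show 1 ≤ ‖z‖ by linarith [hGr z hz])
    rw [← ENNReal.ofReal_one]
    refine ENNReal.ofReal_le_ofReal (Real.exp_le_one_iff.2 ?_)
    nlinarith
  have key := setLIntegral_mul_one_add_lt_top (ρ := ρ) (S := S \ {0}) hΦm hEm
    (c := ENNReal.ofReal δ⁻¹) ENNReal.ofReal_ne_top
    (A := (∫⁻ z in G, Φ z) + singularMass 1 (t * δ))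
    (ENNReal.add_lt_top.2 ⟨hΦfin, singularMass_lt_top one_pos (by linarith)⟩).ne hΦfin.ne
    (fun w => setLIntegral_singular_le one_pos G w hΦm hΦ1 hGm)
  set c : ℝ := C ^ 2 * Real.exp (t * T) with hc
  have hc0 : 0 ≤ c := by positivity
  refine lt_of_le_of_lt ?_ (ENNReal.mul_lt_top (ENNReal.ofReal_lt_top (r := c)) key)
  have hm2 : Measurable fun z => ∫⁻ w in S \ {0}, E z w ∂ρ :=
    Measurable.lintegral_prod_right' (f := fun q : ℂ × ℂ => E q.1 q.2) hEm
  rw [← lintegral_const_mul _ (by fun_prop)]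
  refine lintegral_mono_ae ?_
  filter_upwards [ae_restrict_of_ae (hφ.ae_eq_toReal hne), ae_restrict_mem hGm,
    ae_restrict_of_ae (ae_measure_singleton_eq_zero ρ)] with z hzφ hzG hz
  have hzr := hGr z hzG
  have hz0 : 0 < ‖z‖ := by linarith
  have hz1 : 1 ≤ ‖z‖ := by linarith
  set B := Real.exp 2 * (‖z‖ / 17) with hB
  have hB0 : 0 < B := by positivity
  have he2 : Real.exp 2 < 8 := by
    have h1 : Real.exp 2 = Real.exp 1 * Real.exp 1 := by rw [← Real.exp_add]; norm_num
    have h2 : Real.exp 1 < 2.7182818286 := Real.exp_one_lt_d9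
    have h3 := Real.exp_pos 1
    rw [h1]; nlinarith
  have hBz : B ≤ ‖z‖ / 2 := by rw [hB]; nlinarith
  -- The separated point is taken to be `0`: as `B ≤ |z| / 2`, its potential at `z` vanishes.
  have hb := ofReal_exp_neg_le hφ hne hρ (R := ‖z‖ / 17) (by positivity) (p := 0) hz hzφ (S := S)
    hSm (fun w hw => by
      have hw' : ‖w‖ ≤ s := by simpa [hS] using hw
      have := norm_sub_norm_le z w
      rw [norm_sub_rev] at this
      linarith) ht0 hδ0 hSδ
  rw [← hB, zero_sub, norm_neg, posLog_div_eq_zero hB0 (by linarith), mul_zero, add_zero] at hb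
  set l := Real.log ‖z‖ with hl
  have hl0 : 0 ≤ l := Real.log_nonneg hz1
  -- The cut-off radius `B` grows with `z`. Splitting off `log |z|` reduces it to the fixed radius
  -- `1`, at the price of a factor `|z|^{tδ}`.
  have hint : 1 + ENNReal.ofReal δ⁻¹ * ∫⁻ w in S \ {0}, ENNReal.ofReal
        (Real.exp (t * δ * Real.posLog (B / ‖w - z‖))) ∂ρ
      ≤ ENNReal.ofReal (Real.exp (t * δ * l)) *
        (1 + ENNReal.ofReal δ⁻¹ * ∫⁻ w in S \ {0}, E z w ∂ρ) := by
    have hEz : Measurable (E z) := by fun_prop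
    rw [mul_add, mul_one, mul_left_comm, ← lintegral_const_mul _ hEz]
    gcongr with w
    · rw [← ENNReal.ofReal_one]
      exact ENNReal.ofReal_le_ofReal (Real.one_le_exp (by positivity))
    · rw [hE, ← ENNReal.ofReal_mul (Real.exp_pos _).le, ← Real.exp_add, ← mul_add]
      gcongr
      rw [div_eq_mul_one_div]
      refine Real.posLog_mul.trans (add_le_add_left ?_ _)
      refine (Real.posLog_le_posLog hB0.le (show B ≤ ‖z‖ by linarith)).trans ?_
      rw [Real.posLog_eq_log (by rwa [abs_norm])]
  refine (mul_le_mul_right (hb.trans (mul_le_mul_right hint _)) _).trans ?_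
  rw [← mul_assoc, ← mul_assoc, ← mul_assoc]
  refine mul_le_mul_left ?_ _
  rw [hΦ, ← ENNReal.ofReal_mul (by positivity), ← ENNReal.ofReal_mul (by positivity),
    ← ENNReal.ofReal_mul hc0]
  refine ENNReal.ofReal_le_ofReal ?_
  have h1 : ‖f z‖ ^ 2 ≤ C ^ 2 * Real.exp (2 * d * l) := by
    have h3 : ‖z‖ = Real.exp l := by rw [hl, Real.exp_log hz0]
    have h2 := hf z hz1
    rw [h3] at h2
    calc ‖f z‖ ^ 2 ≤ (C * Real.exp l ^ d) ^ 2 := by gcongr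
      _ = C ^ 2 * Real.exp l ^ (2 * d) := by ring
      _ = _ := by
        rw [← Real.exp_nat_mul]; push_cast; rfl
  have h4 : Real.exp (-t * kernelMean φ (‖z‖ / 17) z)
      ≤ Real.exp (t * T) * Real.exp (-(t * (γ - ε)) * l) := by
    rw [← Real.exp_add]
    refine Real.exp_le_exp.2 ?_
    have := mul_le_mul_of_nonneg_left (hT z (by linarith)) ht0.le
    linarith
  calc ‖f z‖ ^ 2 * Real.exp (-t * kernelMean φ (‖z‖ / 17) z) * Real.exp (t * δ * l)
      ≤ (C ^ 2 * Real.exp (2 * d * l)) * (Real.exp (t * T) * Real.exp (-(t * (γ - ε)) * l))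
        * Real.exp (t * δ * l) := by gcongr
    _ = c * Real.exp (-q * l) := by
      rw [hc, show -q * l = 2 * d * l + -(t * (γ - ε)) * l + t * δ * l by rw [hq]; ring,
        Real.exp_add, Real.exp_add]
      ring

end infinity

/-! ### Polynomial bounds and prescribed roots -/

section polynomial

open Polynomial

lemma ereal_coe_ennreal_natCast (m : ℕ) : ((m : ℝ≥0∞) : EReal) = ((m : ℝ) : EReal) := by
  rw [← ENNReal.ofReal_natCast, EReal.coe_ennreal_ofReal, max_eq_left (Nat.cast_nonneg m)]

lemma exists_norm_eval_le (p : ℂ[X]) :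
    ∃ C, ∀ z : ℂ, 1 ≤ ‖z‖ → ‖p.eval z‖ ≤ C * ‖z‖ ^ p.natDegree := by
  refine ⟨∑ i ∈ Finset.range (p.natDegree + 1), ‖p.coeff i‖, fun z hz => ?_⟩
  rw [eval_eq_sum_range, Finset.sum_mul]
  refine (norm_sum_le _ _).trans (Finset.sum_le_sum fun i hi => ?_)
  rw [norm_mul, norm_pow]
  gcongr
  exact Nat.lt_succ_iff.1 (Finset.mem_range.1 hi)

lemma exists_norm_eval_le_near (p : ℂ[X]) (a : ℂ) :
    ∃ C, ∀ z : ℂ, ‖z - a‖ ≤ 1 → ‖p.eval z‖ ≤ C * ‖z - a‖ ^ p.rootMultiplicity a := by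
  set s := p /ₘ (X - C a) ^ rootMultiplicity a p with hs
  obtain ⟨C', hC'⟩ := (isCompact_closedBall a 1).exists_bound_of_continuousOn
    (f := fun z => s.eval z) s.continuous.continuousOn
  refine ⟨C', fun z hz => ?_⟩
  have h1 := congrArg (eval z) (pow_mul_divByMonic_rootMultiplicity_eq p a)
  rw [← h1, eval_mul, norm_mul, eval_pow, norm_pow, eval_sub, eval_X, eval_C, mul_comm]
  gcongr
  exact hC' z (mem_closedBall_iff_norm.2 hz)

lemma natDegree_prod_X_sub_C_pow {ι : Type*} (s : Finset ι) (a : ι → ℂ) (m : ι → ℕ) :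
    (∏ j ∈ s, (X - C (a j)) ^ m j).natDegree = ∑ j ∈ s, m j := by
  rw [natDegree_prod_of_monic _ _ fun j _ => (monic_X_sub_C _).pow _]
  simp

/-- Powers of distinct linear factors are coprime, so their product divides `p`. -/
lemma sum_le_natDegree {ι : Type*} (s : Finset ι) {a : ι → ℂ} (ha : Function.Injective a)
    {m : ι → ℕ} {p : ℂ[X]} (hp : p ≠ 0) (h : ∀ j, m j ≤ p.rootMultiplicity (a j)) :
    ∑ j ∈ s, m j ≤ p.natDegree := by
  rw [← natDegree_prod_X_sub_C_pow s a m]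
  refine natDegree_le_of_dvd (Finset.prod_dvd_of_coprime (fun i _ j _ hij => ?_) fun j _ => ?_) hp
  · exact (isCoprime_X_sub_C_of_isUnit_sub
      (sub_ne_zero.2 fun h => hij (ha h)).isUnit).pow
  · exact (le_rootMultiplicity_iff hp).1 (h j)

end polynomial

/-! ### Global integrability -/

section weighted

variable {φ : ℂ → EReal} (hφ : IsSubharmonic φ) {γ : ℝ} (hγ : 0 ≤ γ)
  (hlim : limsup (fun z : ℂ => φ z / (Real.log ‖z‖ : EReal)) (Bornology.cobounded ℂ)
      = (γ : EReal))
  {ρ : Measure ℂ} (hρ : IsRieszMeasure φ ρ)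

include hφ hγ hlim hρ

lemma lintegral_weighted_lt_top {p : Polynomial ℂ} {k : ℕ} (hk : 0 < k)
    (hd : (p.natDegree : ℝ) < k * γ - 1)
    (hm : ∀ a, (k : ℝ) * ρ.real {a} < p.rootMultiplicity a + 1) :
    ∫⁻ z, ENNReal.ofReal (‖p.eval z‖ ^ 2) *
      ENNReal.ofReal (Real.exp (-(2 * (k : ℝ)) * (φ z).toReal)) < ⊤ := by
  have hne := exists_ne_bot_of_limsup hlim
  have := isFiniteMeasure_of_limsup hφ hγ hlim hρ
  obtain ⟨C, hC⟩ := exists_norm_eval_le p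
  obtain ⟨r, hr⟩ := exists_compl_setLIntegral_lt_top hφ hγ hlim hρ hk hd hC
  set g : ℂ → ℝ≥0∞ := fun z => ENNReal.ofReal (‖p.eval z‖ ^ 2) *
      ENNReal.ofReal (Real.exp (-(2 * (k : ℝ)) * (φ z).toReal)) with hg
  rw [← lintegral_add_compl g (Metric.isClosed_closedBall.measurableSet (s :=
    Metric.closedBall (0 : ℂ) r))]
  refine ENNReal.add_lt_top.2 ⟨?_, hr⟩
  have hball : MeasurableSet (Metric.closedBall (0 : ℂ) r) :=
    Metric.isClosed_closedBall.measurableSet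
  -- Local finiteness of the measure with density `g` gives finiteness on the compact disc.
  have hlt := (isCompact_closedBall (0 : ℂ) r).measure_lt_top_of_nhdsWithin
    (μ := volume.withDensity g) fun a _ => by
      obtain ⟨C', hC'⟩ := exists_norm_eval_le_near p a
      obtain ⟨B, hB, hBi⟩ := exists_ball_setLIntegral_lt_top hφ hne hρ a hk (hm a) hC'
      refine ⟨Metric.ball a B, mem_nhdsWithin_of_mem_nhds (Metric.ball_mem_nhds a hB), ?_⟩
      rwa [withDensity_apply _ Metric.isOpen_ball.measurableSet]
  rwa [withDensity_apply _ hball] at hlt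

end weighted

/-! ### Atoms of the Riesz measure -/

section decomposition

variable {φ : ℂ → EReal} {ι : Type*} {a : ι → ℂ} {α : ι → ℝ} {μ : Measure ℂ}
  (hdec : IsRieszDecomposition φ a α μ)

include hdec

lemma IsRieszDecomposition.measureReal_singleton (j : ι) :
    (Measure.sum (fun j => ENNReal.ofReal (α j) • Measure.dirac (a j)) + μ).real {a j} = α j := by
  rw [measureReal_def, Measure.add_apply, hdec.null_of_countable _ (Set.countable_singleton _),
    add_zero, Measure.sum_apply _ (measurableSet_singleton _), tsum_eq_single j]
  · simp [(hdec.pos j).le]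
  · intro i hi
    simp [hdec.injective.ne hi]

lemma IsRieszDecomposition.measureReal_singleton_of_notMem {z : ℂ} (hz : z ∉ Set.range a) :
    (Measure.sum (fun j => ENNReal.ofReal (α j) • Measure.dirac (a j)) + μ).real {z} = 0 := by
  rw [measureReal_def, Measure.add_apply, hdec.null_of_countable _ (Set.countable_singleton _),
    add_zero, Measure.sum_apply _ (measurableSet_singleton _)]
  have : ∀ i, a i ≠ z := fun i h => hz ⟨i, h⟩
  simp [this]

end decomposition

/-! ### The equivalence and the degree bound -/

theorem mainTheorem7 {N : ℕ} (φ : ℂ → EReal) (hφ : IsSubharmonic φ)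
    (γ : ℝ) (hγ : 0 ≤ γ)
    (hlim : limsup (fun z : ℂ => φ z / (Real.log ‖z‖ : EReal)) (Bornology.cobounded ℂ)
      = (γ : EReal))
    {ι : Type*} (a : ι → ℂ) (α : ι → ℝ) (μ : Measure ℂ)
    (hdec : IsRieszDecomposition φ a α μ)
    (n : Fin N → ℕ) :
    ((∃ f : ℂ → ℂ, IsBergmanCoefficient φ n f) ↔
      ((∑' j, (⌊((N : ℝ) + ∑ i, (n i : ℝ)) * α j⌋₊ : ℝ≥0∞) : ℝ≥0∞) : EReal)
        < ((((N : ℝ) + ∑ i, (n i : ℝ)) * γ - 1 : ℝ) : EReal)) ∧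
    ∀ f : ℂ → ℂ, IsBergmanCoefficient φ n f →
      ∃ p : Polynomial ℂ, (∀ z, f z = p.eval z) ∧
        (p.natDegree : ℝ) < ((N : ℝ) + ∑ i, (n i : ℝ)) * γ - 1 := by
  have hne := exists_ne_bot_of_limsup hlim
  have hρ := hdec.riesz
  set ρ := Measure.sum (fun j => ENNReal.ofReal (α j) • Measure.dirac (a j)) + μ with hρdef
  simp only [isBergmanCoefficient_iff n hφ hne]
  obtain ⟨k, hk⟩ : ∃ k : ℕ, (k : ℝ) = (N : ℝ) + ∑ i, (n i : ℝ) :=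
    ⟨N + ∑ i, n i, by push_cast; rfl⟩
  rw [← hk]
  have hpoly : ∀ f : ℂ → ℂ, (Differentiable ℂ f ∧ f ≠ 0 ∧
      ∫⁻ z, ENNReal.ofReal (‖f z‖ ^ 2) *
        ENNReal.ofReal (Real.exp (-(2 * (k : ℝ)) * (φ z).toReal)) < ⊤) →
      ∃ p : Polynomial ℂ, p ≠ 0 ∧ (∀ z, f z = p.eval z) ∧ ∫⁻ z, ENNReal.ofReal (‖p.eval z‖ ^ 2) *
        ENNReal.ofReal (Real.exp (-(2 * (k : ℝ)) * (φ z).toReal)) < ⊤ := by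
    rintro f ⟨hf, hf0, hint⟩
    obtain ⟨p, hp⟩ := exists_polynomial_of_weighted hφ hγ hlim hf k hint
    refine ⟨p, ?_, hp, by simpa only [hp] using hint⟩
    rintro rfl
    exact hf0 (funext fun z => by simp [hp z])
  refine ⟨⟨?_, fun hsum => ?_⟩, fun f hf => ?_⟩
  · rintro ⟨f, hf⟩
    obtain ⟨p, hp0, -, hint⟩ := hpoly f hf
    have hdeg := natDegree_lt_of_weighted hφ hγ hlim hρ hp0 k hint
    have hle : (∑' j, (⌊(k : ℝ) * α j⌋₊ : ℝ≥0∞)) ≤ (p.natDegree : ℝ≥0∞) := by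
      rw [ENNReal.tsum_eq_iSup_sum]
      refine iSup_le fun s => ?_
      rw [← Nat.cast_sum]
      refine Nat.cast_le.2 (sum_le_natDegree s hdec.injective hp0 fun j => ?_)
      have := floor_le_rootMultiplicity hφ hlim hρ hp0 k hint (a j)
      rwa [hdec.measureReal_singleton j] at this
    refine (EReal.coe_ennreal_le_coe_ennreal_iff.2 hle).trans_lt ?_
    rw [ereal_coe_ennreal_natCast]
    exact_mod_cast hdeg
  · set m : ι → ℕ := fun j => ⌊(k : ℝ) * α j⌋₊ with hmdef
    have hfin : ∑' j, (m j : ℝ≥0∞) ≠ ⊤ := by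
      intro h
      change ((∑' j, (m j : ℝ≥0∞) : ℝ≥0∞) : EReal) < _ at hsum
      rw [h, EReal.coe_ennreal_top] at hsum
      exact not_top_lt hsum
    -- A finite sum of natural numbers has only finitely many nonzero terms, so the product defining
    -- the witness is finite.
    have hSfin := ENNReal.finite_const_le_of_tsum_ne_top hfin one_ne_zero
    set s := hSfin.toFinset with hs
    have hms : ∀ j, j ∉ s → m j = 0 := by
      intro j hj
      by_contra h0
      refine hj (hSfin.mem_toFinset.2 ?_)
      change (1 : ℝ≥0∞) ≤ m j
      exact_mod_cast Nat.one_le_iff_ne_zero.2 h0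
    change ((∑' j, (m j : ℝ≥0∞) : ℝ≥0∞) : EReal) < _ at hsum
    rw [tsum_eq_sum (s := s) fun j hj => by simp [hms j hj], ← Nat.cast_sum,
      ereal_coe_ennreal_natCast] at hsum
    have hdeg : ((∑ j ∈ s, m j : ℕ) : ℝ) < k * γ - 1 := by exact_mod_cast hsum
    have hk0 : 0 < k := by
      rcases Nat.eq_zero_or_pos k with h | h
      · rw [h, Nat.cast_zero, zero_mul] at hdeg
        have : (0 : ℝ) ≤ ((∑ j ∈ s, m j : ℕ) : ℝ) := Nat.cast_nonneg _
        linarith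
      · exact h
    set p : Polynomial ℂ := ∏ j ∈ s, (Polynomial.X - Polynomial.C (a j)) ^ m j with hp
    have hp0 : p ≠ 0 := by
      rw [hp, Finset.prod_ne_zero_iff]
      exact fun j _ => pow_ne_zero _ (Polynomial.X_sub_C_ne_zero _)
    have hroot : ∀ j, m j ≤ p.rootMultiplicity (a j) := by
      intro j
      by_cases hj : j ∈ s
      · exact (Polynomial.le_rootMultiplicity_iff hp0).2 (Finset.dvd_prod_of_mem _ hj)
      · rw [hms j hj]; exact Nat.zero_le _
    refine ⟨fun z => p.eval z, p.differentiable, fun h => hp0 ?_, ?_⟩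
    · exact Polynomial.funext fun z => by simpa using congrFun h z
    · refine lintegral_weighted_lt_top hφ hγ hlim hρ hk0 ?_ fun z => ?_
      · rwa [hp, natDegree_prod_X_sub_C_pow]
      · by_cases hz : z ∈ Set.range a
        · obtain ⟨j, rfl⟩ := hz
          rw [hdec.measureReal_singleton j]
          -- `kα_j < ⌊kα_j⌋ + 1` is the integrability threshold at `a_j`; points outside the family
          -- carry no mass.
          refine (Nat.lt_floor_add_one _).trans_le ?_
          gcongr
          exact hroot j
        · rw [hdec.measureReal_singleton_of_notMem hz, mul_zero]
          positivity
  · obtain ⟨p, hp0, hp, hint⟩ := hpoly f hf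
    exact ⟨p, hp, natDegree_lt_of_weighted hφ hγ hlim hρ hp0 k hint⟩
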